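/- Let $\mathcal G$ be a finite connected undirected graph (loops and multiple edges allowed) in which every vertex has degree at least $2$ (a loop counting twice) and which is nontrivial, i.e. $|V|<|\mathcal E|$ (first Betti number at least $2$), with edge set $\mathcal E$. Let $\mathcal E^o$ be the set of directed edges (each $e\in\mathcal E$ with its two directions $e,\bar e$), let $A(e,e')=1$ if $e'$ begins where $e$ ends and $e'\ne\bar e$, and $A(e,e')=0$ otherwise, and let $\Sigma=\Sigma_A^+=\{(e_n)_{n\ge0}\in(\mathcal E^o)^{\mathbb N}: A(e_n,e_{n+1})=1\}$ with the shift $\sigma$. Write $\mathcal L_f w(x)=\sum_{\sigma y=x}e^{f(y)}w(y)$. The equilibrium state of $f$ is $m_f=v\mu/\int v\,d\mu$, where $v>0$ is continuous, $\mathcal L_fv=\beta v$ with $\beta>0$, and $\mu$ is a probability measure with $\mathcal L_f^*\mu=\beta\mu$. Further, $\mathrm{Var}(w,m)=\lim_{n\to\infty}\frac1n\int\big(\sum_{k<n}w\circ\sigma^k-n\int w\,dm\big)^2dm$. Let $\mathcal M^1_{\mathcal G}$ be the set of $l:\mathcal E\to\mathbb R_{>0}$ with entropy $h(l)=\lim_{T\to\infty}\frac1T\log\#\{\gamma: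 l(\gamma)<T\}=1$, where $\gamma=(e_0,\dots,e_n=e_0)$, $n\ge1$, runs over the closed cycles with $A(e_i,e_{i+1})=1$ for $0\le i<n$, and $l(\gamma)=\sum_{i<n}l(e_i)$. A function $l$ on $\mathcal E$ is also regarded as a function on $\mathcal E^o$ (with $l(\bar e)=l(e)$) and on $\Sigma$ (with $l(\underline e)=l(e_0)$). For $l\in\mathcal M^1_{\mathcal G}$ let $\mathbf v>0$ satisfy $\sum_i\mathbf v(i)A(i,j)e^{-l(i)}=\mathbf v(j)$, let $P(i,j)=A(i,j)\mathbf v(i)e^{-l(i)}/\mathbf v(j)$, and let $\mathbf p$ satisfy $P\mathbf p=\mathbf p$, $\sum_i\mathbf p_i=1$. The tangent space $T_l\mathcal M^1_{\mathcal G}$ is defined as the set of functions $\phi:\Sigma\to\mathbb R$ that depend only on $e_0$ and satisfy $\int\phi\,dm_{-l}=0$. For every $l\in\mathcal M^1_{\mathcal G}$, such $\mathbf v,\mathbf p$ exist, $m_{-l}$ exists and is unique, there is a unique normalised potential $g$ cohomologous to $-l$ (i.e. $\mathcal L_g1=1$ and $-l=g+h\circ\sigma-h$ for some continuous $h:\Sigma\to\mathbb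 R$), and $m_g$ exists and is unique. Moreover: 1. For every $l\in\mathcal M^1_{\mathcal G}$, $$T_l\mathcal M^1_{\mathcal G}=\Big\{\phi\in C(\Sigma): \phi(\underline e)=\phi(e_0)\ \text{and}\ \sum_{e\in\mathcal E^o}\phi(e)\mathbf p_e=0\Big\}.$$ 2. Let $\varepsilon>0$, let $(l_t)_{t\in(-\varepsilon,\varepsilon)}$ be a $C^\infty$ path in $\mathcal M^1_{\mathcal G}$, and let $g_t$ be the normalised potential cohomologous to $-l_t$. Then $g_t(\underline e)=g_t(e_0,e_1)$ depends only on the first two coordinates and is $C^\infty$ in $t$. With $P,\mathbf p$ associated with $l_0$ we have $P(i,j)=A(i,j)e^{g_0(i,j)}$, the variance below exists, and $$\mathrm{Var}(-\dot l_0,m_{-l_0})=\int\ddot l_0\,dm_{-l_0}=\sum_{i\in\mathcal E^o}\ddot l_0(i)\,\mathbf p_i=\int(\dot g_0)^2\,dm_{g_0}=\sum_{i,j\in\mathcal E^o}\dot g_0(i,j)^2\,P_{ij}\,\mathbf p_j .$$ (Values $g_t(i,j)$ with $A(i,j)=0$ are irrelevant, since then $P_{ij}=0$.) -/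

import Mathlib

open Filter Topology MeasureTheory Matrix
open scoped ContDiff

noncomputable section

/-! ### One-sided subshifts of finite type -/

/-- The one-sided subshift of finite type of a `0`-`1` matrix `A`: all sequences
`x₀ x₁ x₂ …` with `A (xₙ, xₙ₊₁) = 1` for every `n`. -/
def SFT {ι : Type*} (A : Matrix ι ι ℝ) : Type _ :=
  {x : ℕ → ι // ∀ n, A (x n) (x (n + 1)) = 1}

namespace SFT

variable {ι : Type*} {A : Matrix ι ι ℝ}

instance : CoeFun (SFT A) (fun _ => ℕ → ι) := ⟨fun x => x.1⟩

/-- The product topology (the alphabet carries the discrete topology where this is used). -/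
instance [TopologicalSpace ι] : TopologicalSpace (SFT A) :=
  inferInstanceAs (TopologicalSpace {x : ℕ → ι // ∀ n, A (x n) (x (n + 1)) = 1})

instance [TopologicalSpace ι] : MeasurableSpace (SFT A) := borel _

instance [TopologicalSpace ι] : BorelSpace (SFT A) := ⟨rfl⟩

/-- The shift map `(σ x)ₙ = xₙ₊₁`. -/
def shift (x : SFT A) : SFT A := ⟨fun n => x.1 (n + 1), fun n => x.2 (n + 1)⟩

/-- Over a finite alphabet the shift has finite fibres, so that the sum which defines the
transfer operator is a genuine finite sum. -/
theorem finite_fibre [Finite ι] (x : SFT A) : {y : SFT A | shift y = x}.Finite := by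
  refine Set.Finite.of_finite_image (f := fun y : SFT A => y 0) (Set.toFinite _) ?_
  intro y hy z hz hyz
  apply Subtype.ext
  funext n
  cases n with
  | zero => exact hyz
  | succ n =>
    have h : shift y = shift z := hy.trans hz.symm
    exact congrFun (congrArg Subtype.val h) n

/-- The transfer (Ruelle) operator `(L_f w)(x) = ∑_{σ y = x} e^{f y} w y`. -/
def transfer (f w : SFT A → ℝ) (x : SFT A) : ℝ :=
  ∑ᶠ y ∈ {y : SFT A | shift y = x}, Real.exp (f y) * w y

/-- `f` is normalised: `L_f 1 = 1`. -/
def IsNormalized (f : SFT A → ℝ) : Prop :=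
  ∀ x, transfer f (fun _ => 1) x = 1

/-- Livšic cohomology: `f - g = h ∘ σ - h` for some continuous `h`. -/
def Cohomologous [TopologicalSpace ι] (f g : SFT A → ℝ) : Prop :=
  ∃ h : C(SFT A, ℝ), ∀ x, f x - g x = h (shift x) - h x

/-- `m` is the equilibrium state of `f`, that is `m = v μ / ∫ v dμ`, where
`v > 0` is the eigenfunction, `L_f v = β v`, and `μ` is the eigenmeasure, the probability
measure with `L_f^* μ = β μ` (the eigenvalue with a positive eigenfunction is the maximal one). -/
def IsEquilibriumState [TopologicalSpace ι] (f : SFT A → ℝ) (m : Measure (SFT A)) : Prop :=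
  ∃ (β : ℝ) (v : C(SFT A, ℝ)) (μ : Measure (SFT A)),
    0 < β ∧ (∀ x, 0 < v x) ∧ (∀ x, transfer f v x = β * v x) ∧
    IsProbabilityMeasure μ ∧
    (∀ φ : C(SFT A, ℝ), ∫ x, transfer f φ x ∂μ = β * ∫ x, φ x ∂μ) ∧
    m = (ENNReal.ofReal (∫ x, v x ∂μ))⁻¹ • μ.withDensity (fun x => ENNReal.ofReal (v x))

/-- `Var (w, m) = V`: the limit
`lim (1/n) ∫ (w + w ∘ σ + … + w ∘ σⁿ⁻¹ - n ∫ w dm)² dm` exists and equals `V`. -/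
def HasVariance [TopologicalSpace ι] (w : SFT A → ℝ) (m : Measure (SFT A)) (V : ℝ) : Prop :=
  Tendsto (fun n : ℕ => (1 / (n : ℝ)) *
      ∫ x, (birkhoffSum shift w n x - n * ∫ y, w y ∂m) ^ 2 ∂m) atTop (𝓝 V)

end SFT

/-! ### Undirected graphs and their directed edges -/

/-- An undirected graph with vertex set `V` and edge set `E`; loops and multiple edges are
allowed. Every edge is listed with a reference order of its two endpoints. -/
structure UGraph (V E : Type*) where
  /-- the first endpoint of an edge -/
  src : E → V
  /-- the second endpoint of an edge -/
  tgt : E → V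

/-- Directed edges: every edge carries two opposite directions. -/
def DirEdge (E : Type*) : Type _ := E × Bool

namespace DirEdge

variable {E : Type*}

instance [Fintype E] : Fintype (DirEdge E) := inferInstanceAs (Fintype (E × Bool))

instance : TopologicalSpace (DirEdge E) := ⊥

instance : DiscreteTopology (DirEdge E) := ⟨rfl⟩

/-- The undirected edge that underlies a directed edge. -/
def edge (d : DirEdge E) : E := d.1

/-- The same edge with the opposite direction. -/
def rev (d : DirEdge E) : DirEdge E := (d.1, !d.2)

end DirEdge

namespace UGraph

variable {V E : Type*} (G : UGraph V E)

/-- The vertex at which a directed edge begins. -/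
def init (d : DirEdge E) : V := if d.2 then G.src d.1 else G.tgt d.1

/-- The vertex at which a directed edge ends. -/
def term (d : DirEdge E) : V := if d.2 then G.tgt d.1 else G.src d.1

/-- Any two vertices are joined by a path. -/
def Connected : Prop :=
  ∀ u v : V, Relation.ReflTransGen (fun a b => ∃ d, G.init d = a ∧ G.term d = b) u v

/-- The degree of a vertex, the number of directed edges that begin there
(so a loop counts twice). -/
def degree (u : V) : ℕ := {d : DirEdge E | G.init d = u}.ncard

open Classical in
/-- The adjacency matrix on directed edges: `A (e, e') = 1` if `e'` follows `e` and is not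
the reversal of `e`. -/
def adj : Matrix (DirEdge E) (DirEdge E) ℝ :=
  fun e e' => if G.term e = G.init e' ∧ e' ≠ e.rev then 1 else 0

/-- The closed cycles without backtracking `γ = (e₀, e₁, …, eₙ = e₀)`, `n ≥ 1`, with
`l(γ) = l(e₀) + … + l(eₙ₋₁) < T`. -/
def closedCycles (l : E → ℝ) (T : ℝ) : Set (Σ n : ℕ, Fin (n + 1) → DirEdge E) :=
  {γ | 1 ≤ γ.1 ∧ γ.2 (Fin.last γ.1) = γ.2 0 ∧
    (∀ i : Fin γ.1, G.adj (γ.2 i.castSucc) (γ.2 i.succ) = 1) ∧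
    ∑ i : Fin γ.1, l (γ.2 i.castSucc).edge < T}

/-- The entropy `h(l) = lim (1/T) log #{γ; l(γ) < T}` exists and equals `h`. -/
def HasEntropy (l : E → ℝ) (h : ℝ) : Prop :=
  Tendsto (fun T : ℝ => (1 / T) * Real.log ((G.closedCycles l T).ncard : ℝ)) atTop (𝓝 h)

/-- The space of all positive edge weightings with entropy one. -/
def entropyOne : Set (E → ℝ) := {l | (∀ e, 0 < l e) ∧ G.HasEntropy l 1}

/-- An edge function as a function on the shift space, `l(e₀ e₁ …) = l(e₀)`. -/
def onShift (l : E → ℝ) (x : SFT G.adj) : ℝ := l (x 0).edge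

/-- The tangent space at an edge weighting `l` of entropy one whose equilibrium state
`m_{-l}` is `m`: functions of the zeroth directed edge with integral zero. -/
def tangentSpace (m : Measure (SFT G.adj)) : Set (SFT G.adj → ℝ) :=
  {φ | (∀ x y : SFT G.adj, x 0 = y 0 → φ x = φ y) ∧ ∫ x, φ x ∂m = 0}

/-- The weighted adjacency matrix `A_{-l}(i, j) = A(i, j) e^{-l(i)}`. -/
def weighted (l : E → ℝ) : Matrix (DirEdge E) (DirEdge E) ℝ :=
  fun i j => G.adj i j * Real.exp (-l i.edge)

/-- The matrix `P(i, j) = A(i, j) v(i) e^{-l(i)} / v(j)`. -/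
def transition (l : E → ℝ) (v : DirEdge E → ℝ) : Matrix (DirEdge E) (DirEdge E) ℝ :=
  fun i j => G.adj i j * v i * Real.exp (-l i.edge) / v j

/-- `v` is a positive left eigenvector of `A_{-l}` for the eigenvalue `1`, and `p` is the right
eigenvector of the associated matrix `P` for the eigenvalue `1` whose entries sum to one. -/
def IsPerronData [Fintype E] (l : E → ℝ) (v p : DirEdge E → ℝ) : Prop :=
  (∀ i, 0 < v i) ∧ v ᵥ* G.weighted l = v ∧ G.transition l v *ᵥ p = p ∧ ∑ i, p i = 1

/-- `g` is the normalised potential cohomologous to `-l`. -/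
def IsNormalizedPotential (l : E → ℝ) (g : SFT G.adj → ℝ) : Prop :=
  SFT.IsNormalized g ∧ SFT.Cohomologous (fun x => -G.onShift l x) g

end UGraph

end

/-!
A finite connected graph with minimal degree two and more edges than vertices has a strongly
connected graph of non-backtracking directed edges, so Perron–Frobenius theory applies to the
matrix `A e^{-l}`. Counting closed cycles by traces of its powers shows that entropy one means
Perron eigenvalue one. Conjugating by the eigenvector `v` gives a stochastic matrix `P`; since
`log P` is a normalised potential cohomologous to `-l`, both potentials have as equilibrium state
the Markov measure of `P`.

Along a path, `v` depends smoothly on `t` because the eigenvalue is simple, so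
`g_t(i, j) = -l_t(i) + log v_t(i) - log v_t(j)` on admissible pairs. Differentiating
`∑ i, A(i, j) e^{g_t(i, j)} = 1` once shows that `ġ` is a martingale difference for the Markov
measure, whence `Var(-l̇) = Var(ġ) = ∫ ġ²`; differentiating twice gives `∫ (ġ² + g̈) = 0`, and
`∫ g̈ = -∫ l̈` because the two differ by a coboundary.
-/

noncomputable section

theorem sum_ncard_fiber {α β : Type*} [Finite α] [Fintype β] (s : Set α) (f : α → β) :
    ∑ b, {a ∈ s | f a = b}.ncard = s.ncard := by
  classical
  have hfiber (b : β) : {a ∈ s | f a = b}.ncard = {a ∈ s.toFinite.toFinset | f a = b}.card := by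
    rw [← Set.ncard_coe_finset]
    simp
  simp only [hfiber]
  rw [Set.ncard_eq_toFinset_card s, Finset.card_eq_sum_card_fiberwise (f := f) (t := Finset.univ)]
  exact fun _ _ => Finset.mem_coe.2 (Finset.mem_univ _)

namespace DirEdge

variable {E : Type*}

instance [Finite E] : Finite (DirEdge E) := inferInstanceAs (Finite (E × Bool))

theorem rev_rev (d : DirEdge E) : d.rev.rev = d :=
  Prod.ext rfl (Bool.not_not d.2)

theorem rev_injective : Function.Injective (rev : DirEdge E → DirEdge E) :=
  Function.LeftInverse.injective rev_rev

theorem card : Nat.card (DirEdge E) = 2 * Nat.card E := by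
  calc Nat.card (E × Bool)
    _ = Nat.card E * Nat.card Bool := Nat.card_prod E Bool
    _ = 2 * Nat.card E := by rw [mul_comm, Nat.card_eq_fintype_card (α := Bool), Fintype.card_bool]

end DirEdge

namespace UGraph

variable {V E : Type*} (G : UGraph V E)

theorem init_rev (d : DirEdge E) : G.init d.rev = G.term d := by
  obtain ⟨e, b⟩ := d
  cases b <;> rfl

theorem term_rev (d : DirEdge E) : G.term d.rev = G.init d := by
  obtain ⟨e, b⟩ := d
  cases b <;> rfl

theorem adj_eq_one_iff (e f : DirEdge E) :
    G.adj e f = 1 ↔ G.term e = G.init f ∧ f ≠ e.rev := by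
  unfold adj
  split_ifs with h <;> simp [h]

theorem adj_eq_zero_or_one (e f : DirEdge E) : G.adj e f = 0 ∨ G.adj e f = 1 := by
  unfold adj
  split_ifs <;> simp

theorem adj_nonneg (e f : DirEdge E) : 0 ≤ G.adj e f := by
  rcases G.adj_eq_zero_or_one e f with h | h <;> simp [h]

theorem adj_pos_iff (e f : DirEdge E) : 0 < G.adj e f ↔ G.adj e f = 1 := by
  rcases G.adj_eq_zero_or_one e f with h | h <;> simp [h]

/-- The in-degree of `u` in the set `S` of directed edges. -/
def inCard (S : Set (DirEdge E)) (u : V) : ℕ := {d ∈ S | G.term d = u}.ncard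

/-- The out-degree of `u` in the set `S` of directed edges. -/
def outCard (S : Set (DirEdge E)) (u : V) : ℕ := {d ∈ S | G.init d = u}.ncard

/-- `S` contains every non-backtracking continuation of its elements. -/
def IsForwardClosed (S : Set (DirEdge E)) : Prop := ∀ e ∈ S, ∀ f, G.adj e f = 1 → f ∈ S

theorem outCard_univ (u : V) : G.outCard Set.univ u = G.degree u := by
  simp only [outCard, degree, Set.mem_univ, true_and]

theorem inCard_univ (u : V) : G.inCard Set.univ u = G.degree u := by
  rw [← outCard_univ, outCard, ← Set.ncard_image_of_injective _ DirEdge.rev_injective, inCard]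
  congr 1
  ext d
  refine ⟨fun hd => ⟨d.rev, ⟨trivial, (G.init_rev d).trans hd.2⟩, d.rev_rev⟩, ?_⟩
  rintro ⟨d, hd, rfl⟩
  exact ⟨trivial, (G.term_rev d).trans hd.2⟩

theorem sum_degree [Fintype V] [Finite E] : ∑ u, G.degree u = 2 * Nat.card E := by
  simp only [← outCard_univ, outCard, sum_ncard_fiber, Set.ncard_univ, DirEdge.card]

theorem Connected.forall_of_exists {G : UGraph V E} (hconn : G.Connected) {p : V → Prop}
    (hp : ∀ d, p (G.init d) → p (G.term d)) {u : V} (hu : p u) (w : V) : p w := by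
  induction hconn u w with
  | refl => exact hu
  | tail _ h ih =>
    obtain ⟨d, rfl, rfl⟩ := h
    exact hp d ih

section ForwardClosed

variable {G} {S : Set (DirEdge E)} {d a : DirEdge E} {u : V}

theorem outCard_eq_degree (h : ∀ d, G.init d = u → d ∈ S) : G.outCard S u = G.degree u := by
  rw [outCard, degree]
  congr 1
  ext d
  exact and_iff_right_of_imp (h d)

theorem IsForwardClosed.mem_of_ne_rev (hS : G.IsForwardClosed S) (ha : a ∈ S)
    (hd : G.init d = G.term a) (hne : d ≠ a.rev) : d ∈ S :=
  hS a ha d ((G.adj_eq_one_iff a d).2 ⟨hd.symm, hne⟩)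

theorem exists_adj (hdeg : ∀ u, 2 ≤ G.degree u) (e : DirEdge E) : ∃ f, G.adj e f = 1 := by
  obtain ⟨f, hf, hne⟩ := Set.exists_ne_of_one_lt_ncard (hdeg (G.term e)) e.rev
  exact ⟨f, (G.adj_eq_one_iff e f).2 ⟨hf.symm, hne⟩⟩

variable [Finite E]

theorem inCard_term_pos (hd : d ∈ S) : 0 < G.inCard S (G.term d) :=
  (Set.ncard_pos).2 ⟨d, hd, rfl⟩

theorem outCard_init_pos (hd : d ∈ S) : 0 < G.outCard S (G.init d) :=
  (Set.ncard_pos).2 ⟨d, hd, rfl⟩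

theorem exists_mem_of_inCard_pos (h : 0 < G.inCard S u) : ∃ a ∈ S, G.term a = u :=
  (Set.ncard_pos).1 h

namespace IsForwardClosed

theorem degree_le_outCard_add_one (hS : G.IsForwardClosed S) (ha : a ∈ S) :
    G.degree (G.term a) ≤ G.outCard S (G.term a) + 1 := by
  have hsub : {d | G.init d = G.term a} ⊆ insert a.rev {d ∈ S | G.init d = G.term a} := by
    intro d hd
    by_cases hda : d = a.rev
    · exact Or.inl hda
    · exact Or.inr ⟨hS.mem_of_ne_rev ha hd hda, hd⟩
  exact (Set.ncard_le_ncard hsub).trans (Set.ncard_insert_le _ _)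

-- Two edges of `S` that end at the same vertex cannot both be reversed by `d`.
theorem mem_of_two_le_inCard_init (hS : G.IsForwardClosed S) (h : 2 ≤ G.inCard S (G.init d)) :
    d ∈ S := by
  obtain ⟨a, ha, b, hb, hab⟩ := Set.one_lt_ncard_iff_nontrivial.1 h
  by_cases hda : d = a.rev
  · exact hS.mem_of_ne_rev hb.1 hb.2.symm fun hdb => hab (DirEdge.rev_injective (hda ▸ hdb))
  · exact hS.mem_of_ne_rev ha.1 ha.2.symm hda

theorem outCard_eq_degree (hS : G.IsForwardClosed S) (h : 2 ≤ G.inCard S u) :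
    G.outCard S u = G.degree u :=
  UGraph.outCard_eq_degree fun _ hd => hS.mem_of_two_le_inCard_init (hd ▸ h)

theorem inCard_le_outCard (hS : G.IsForwardClosed S) (hdeg : ∀ u, 2 ≤ G.degree u) (u : V) :
    G.inCard S u ≤ G.outCard S u := by
  rcases Nat.lt_or_ge (G.inCard S u) 2 with h | h
  · rcases Nat.eq_zero_or_pos (G.inCard S u) with h₀ | h₀
    · exact h₀ ▸ Nat.zero_le _
    · obtain ⟨a, ha, rfl⟩ := exists_mem_of_inCard_pos h₀
      have := hS.degree_le_outCard_add_one ha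
      have := hdeg (G.term a)
      omega
  · calc G.inCard S u
      _ ≤ G.inCard Set.univ u := Set.ncard_le_ncard fun d hd => ⟨trivial, hd.2⟩
      _ = G.outCard S u := by rw [inCard_univ, hS.outCard_eq_degree h]

theorem inCard_eq_outCard [Finite V] (hS : G.IsForwardClosed S) (hdeg : ∀ u, 2 ≤ G.degree u)
    (u : V) : G.inCard S u = G.outCard S u := by
  have := Fintype.ofFinite V
  have hsum : ∑ u, G.inCard S u = ∑ u, G.outCard S u :=
    (sum_ncard_fiber S G.term).trans (sum_ncard_fiber S G.init).symm
  exact (Finset.sum_eq_sum_iff_of_le fun u _ => hS.inCard_le_outCard hdeg u).1 hsum u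
    (Finset.mem_univ u)

theorem mem_of_two_le_inCard_term [Finite V] (hS : G.IsForwardClosed S)
    (hdeg : ∀ u, 2 ≤ G.degree u) (h : 2 ≤ G.inCard S (G.term d)) : d ∈ S := by
  have hcard : G.inCard Set.univ (G.term d) = G.inCard S (G.term d) := by
    rw [inCard_univ, hS.inCard_eq_outCard hdeg, hS.outCard_eq_degree h]
  have hsub : {a ∈ S | G.term a = G.term d} ⊆ {a ∈ Set.univ | G.term a = G.term d} :=
    fun a ha => ⟨trivial, ha.2⟩
  have hd : d ∈ {a ∈ S | G.term a = G.term d} :=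
    Set.eq_of_subset_of_ncard_le hsub hcard.le ▸ ⟨trivial, rfl⟩
  exact hd.1

theorem inCard_pos [Finite V] (hS : G.IsForwardClosed S) (hconn : G.Connected)
    (hdeg : ∀ u, 2 ≤ G.degree u) (hne : S.Nonempty) (u : V) : 0 < G.inCard S u := by
  obtain ⟨d₀, hd₀⟩ := hne
  refine hconn.forall_of_exists (p := fun u => 0 < G.inCard S u) (fun d hd => ?_)
    (inCard_term_pos hd₀) u
  obtain ⟨a, ha, had⟩ := exists_mem_of_inCard_pos hd
  by_cases hda : d = a.rev
  · rw [hda, term_rev, hS.inCard_eq_outCard hdeg]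
    exact outCard_init_pos ha
  · exact inCard_term_pos (hS.mem_of_ne_rev ha had.symm hda)

theorem exists_two_le_inCard [Finite V] (hS : G.IsForwardClosed S) (hconn : G.Connected)
    (hdeg : ∀ u, 2 ≤ G.degree u) (hrank : Nat.card V < Nat.card E) (hne : S.Nonempty) :
    ∃ u, 2 ≤ G.inCard S u := by
  have := Fintype.ofFinite V
  by_contra! hlt
  have hdeg_le (u : V) : G.degree u ≤ 2 := by
    obtain ⟨a, ha, rfl⟩ := exists_mem_of_inCard_pos (hS.inCard_pos hconn hdeg hne u)
    have := hS.degree_le_outCard_add_one ha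
    have := hlt (G.term a)
    have := hS.inCard_eq_outCard hdeg (G.term a)
    omega
  have hsum : 2 * Nat.card E ≤ 2 * Nat.card V := by
    calc 2 * Nat.card E
      _ = ∑ u, G.degree u := G.sum_degree.symm
      _ ≤ ∑ _u : V, 2 := Finset.sum_le_sum fun u _ => hdeg_le u
      _ = 2 * Nat.card V := by simp [mul_comm]
  omega

theorem two_le_inCard_term [Finite V] (hS : G.IsForwardClosed S) (hdeg : ∀ u, 2 ≤ G.degree u)
    (h : 2 ≤ G.inCard S (G.init d)) : 2 ≤ G.inCard S (G.term d) := by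
  have hd : d ∈ S := hS.mem_of_two_le_inCard_init h
  have hrev : d.rev ∈ S := hS.mem_of_two_le_inCard_term hdeg (by rwa [term_rev])
  rw [hS.inCard_eq_outCard hdeg, UGraph.outCard_eq_degree]
  · exact hdeg _
  · intro b hb
    by_cases hbd : b = d.rev
    · exact hbd ▸ hrev
    · exact hS.mem_of_ne_rev hd hb hbd

theorem eq_univ [Finite V] (hS : G.IsForwardClosed S) (hconn : G.Connected)
    (hdeg : ∀ u, 2 ≤ G.degree u) (hrank : Nat.card V < Nat.card E) (hne : S.Nonempty) :
    S = Set.univ := by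
  obtain ⟨u, hu⟩ := hS.exists_two_le_inCard hconn hdeg hrank hne
  exact Set.eq_univ_of_forall fun d => hS.mem_of_two_le_inCard_init <|
    hconn.forall_of_exists (p := fun u => 2 ≤ G.inCard S u)
      (fun _ => hS.two_le_inCard_term hdeg) hu (G.init d)

end IsForwardClosed

end ForwardClosed

theorem transGen_adj [Finite V] [Finite E] {G : UGraph V E} (hconn : G.Connected)
    (hdeg : ∀ u, 2 ≤ G.degree u) (hrank : Nat.card V < Nat.card E) (e f : DirEdge E) :
    Relation.TransGen (fun a b => G.adj a b = 1) e f := by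
  let S : Set (DirEdge E) := {f | Relation.TransGen (fun a b => G.adj a b = 1) e f}
  have hS : G.IsForwardClosed S := fun a ha b hab => Relation.TransGen.tail ha hab
  have hne : S.Nonempty := (exists_adj hdeg e).imp fun f hf => Relation.TransGen.single hf
  exact (hS.eq_univ hconn hdeg hrank hne).ge (Set.mem_univ f)

end UGraph

section PerronFrobenius

theorem isIrreducible_of_transGen {ι : Type*} {B : Matrix ι ι ℝ} (hB : ∀ i j, 0 ≤ B i j)
    (h : ∀ i j, Relation.TransGen (fun a b => 0 < B a b) i j) : B.IsIrreducible := by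
  let : Quiver ι := B.toQuiver
  refine ⟨hB, fun i j => ?_⟩
  induction h i j with
  | single hij => exact ⟨Quiver.Hom.toPath ⟨hij⟩, Nat.one_pos⟩
  | tail _ hjk ih =>
    obtain ⟨p, -⟩ := ih
    exact ⟨p.cons ⟨hjk⟩, Nat.succ_pos _⟩

variable {ι : Type*} [Fintype ι] {B : Matrix ι ι ℝ}

theorem vecMul_le_vecMul (hB : ∀ i j, 0 ≤ B i j) {x y : ι → ℝ} (h : x ≤ y) :
    x ᵥ* B ≤ y ᵥ* B :=
  fun j => Finset.sum_le_sum fun i _ => mul_le_mul_of_nonneg_right (h i) (hB i j)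

theorem vecMul_pos_of_pos (hB : ∀ i j, 0 < B i j) {y : ι → ℝ} (hy : 0 ≤ y) (hne : y ≠ 0)
    (j : ι) : 0 < (y ᵥ* B) j := by
  obtain ⟨i, hi⟩ := Function.ne_iff.1 hne
  exact Finset.sum_pos' (fun a _ => mul_nonneg (hy a) (hB a j).le)
    ⟨i, Finset.mem_univ i, mul_pos ((hy i).lt_of_ne' hi) (hB i j)⟩

theorem inv_sum_smul_mem_stdSimplex [Nonempty ι] {z : ι → ℝ} (hz : ∀ i, 0 < z i) :
    (∑ i, z i)⁻¹ • z ∈ stdSimplex ℝ ι := by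
  have hs : 0 < ∑ i, z i := Finset.sum_pos (fun i _ => hz i) Finset.univ_nonempty
  refine ⟨fun i => (mul_pos (inv_pos.2 hs) (hz i)).le, ?_⟩
  simp only [Pi.smul_apply, smul_eq_mul, ← Finset.mul_sum]
  exact inv_mul_cancel₀ hs.ne'

/-- The Collatz–Wielandt set of `B`: pairs of a probability vector `x` and a number `r ≥ 0`
with `r x ≤ x B`. The largest such `r` is the Perron eigenvalue. -/
def collatzWielandt (B : Matrix ι ι ℝ) : Set ((ι → ℝ) × ℝ) :=
  {z | z.1 ∈ stdSimplex ℝ ι ∧ 0 ≤ z.2 ∧ z.2 • z.1 ≤ z.1 ᵥ* B}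

theorem le_sum_of_mem_collatzWielandt (hB : ∀ i j, 0 ≤ B i j) {z : (ι → ℝ) × ℝ}
    (hz : z ∈ collatzWielandt B) : z.2 ≤ ∑ j, ∑ i, B i j := by
  obtain ⟨x, r⟩ := z
  obtain ⟨hx, -, hxr⟩ := hz
  have hx_le (i : ι) : x i ≤ 1 :=
    (Finset.single_le_sum (fun a _ => hx.1 a) (Finset.mem_univ i)).trans hx.2.le
  calc r
    _ = ∑ j, r * x j := by rw [← Finset.mul_sum, hx.2, mul_one]
    _ ≤ ∑ j, (x ᵥ* B) j := Finset.sum_le_sum fun j _ => hxr j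
    _ ≤ ∑ j, ∑ i, B i j := Finset.sum_le_sum fun j _ => Finset.sum_le_sum fun i _ =>
        mul_le_of_le_one_left (hB i j) (hx_le i)

theorem isCompact_collatzWielandt (hB : ∀ i j, 0 ≤ B i j) : IsCompact (collatzWielandt B) := by
  have hclosed : IsClosed {z : (ι → ℝ) × ℝ | z.2 • z.1 ≤ z.1 ᵥ* B} :=
    isClosed_le (by fun_prop) (continuous_pi fun j => by
      simp only [vecMul, dotProduct]
      fun_prop)
  convert ((isCompact_stdSimplex ℝ ι).prod
    (isCompact_Icc (a := (0 : ℝ)) (b := ∑ j, ∑ i, B i j))).inter_right hclosed using 1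
  ext z
  exact ⟨fun hz => ⟨⟨hz.1, hz.2.1, le_sum_of_mem_collatzWielandt hB hz⟩, hz.2.2⟩,
    fun hz => ⟨hz.1.1, hz.1.2.1, hz.2⟩⟩

theorem collatzWielandt_nonempty [Nonempty ι] (hB : ∀ i j, 0 ≤ B i j) :
    (collatzWielandt B).Nonempty := by
  classical
  obtain ⟨i⟩ := ‹Nonempty ι›
  have hi : (Pi.single i 1 : ι → ℝ) ∈ stdSimplex ℝ ι := single_mem_stdSimplex ℝ i
  exact ⟨(Pi.single i 1, 0), hi, le_rfl, fun j => by simp [hB]⟩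

theorem exists_gt_mem_collatzWielandt [Nonempty ι] {z : ι → ℝ} (hz : ∀ j, 0 < z j) {r : ℝ}
    (hr : 0 ≤ r) (h : ∀ j, r * z j < (z ᵥ* B) j) :
    ∃ w s, r < s ∧ (w, s) ∈ collatzWielandt B := by
  obtain ⟨j₀, hj₀⟩ := Finite.exists_min fun j => (z ᵥ* B) j / z j
  have hrs : r < (z ᵥ* B) j₀ / z j₀ := (lt_div_iff₀ (hz j₀)).2 (h j₀)
  have hs : 0 ≤ (∑ j, z j)⁻¹ := inv_nonneg.2 (Finset.sum_nonneg fun j _ => (hz j).le)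
  refine ⟨(∑ j, z j)⁻¹ • z, _, hrs, inv_sum_smul_mem_stdSimplex hz, hr.trans hrs.le, ?_⟩
  change _ • (∑ j, z j)⁻¹ • z ≤ ((∑ j, z j)⁻¹ • z) ᵥ* B
  rw [smul_vecMul, smul_comm]
  exact smul_le_smul_of_nonneg_left (fun j => (le_div_iff₀ (hz j)).1 (hj₀ j)) hs

theorem exists_sum_pow_pos [DecidableEq ι] (hirr : B.IsIrreducible) :
    ∃ N : ℕ, ∀ i j, 0 < (∑ k ∈ Finset.range N, B ^ k) i j := by
  choose k _ hk using (isIrreducible_iff_exists_pow_pos hirr.nonneg).1 hirr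
  obtain ⟨N, hN⟩ := (Set.finite_range fun z : ι × ι => k z.1 z.2).bddAbove
  refine ⟨N + 1, fun i j => ?_⟩
  rw [Matrix.sum_apply]
  exact Finset.sum_pos' (fun n _ => Matrix.pow_apply_nonneg hirr.nonneg n i j)
    ⟨k i j, Finset.mem_range.2 (Nat.lt_succ_of_le (hN ⟨(i, j), rfl⟩)), hk i j⟩

theorem vecMul_pow_eq_smul [DecidableEq ι] {x : ι → ℝ} {r : ℝ} (h : x ᵥ* B = r • x) (k : ℕ) :
    x ᵥ* B ^ k = r ^ k • x := by
  induction k with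
  | zero => simp
  | succ k ih => rw [pow_succ, ← vecMul_vecMul, ih, smul_vecMul, h, smul_smul, pow_succ]

theorem pos_of_vecMul_eq_smul (hirr : B.IsIrreducible) {x : ι → ℝ} {r : ℝ} (hx : 0 ≤ x)
    (hne : x ≠ 0) (h : x ᵥ* B = r • x) (j : ι) : 0 < x j := by
  classical
  refine (hx j).lt_of_ne' fun hj => hne (funext fun i => ?_)
  obtain ⟨k, -, hk⟩ := (isIrreducible_iff_exists_pow_pos hirr.nonneg).1 hirr i j
  have hsum : (x ᵥ* B ^ k) j = 0 := by
    rw [vecMul_pow_eq_smul h, Pi.smul_apply, hj, Pi.zero_apply, smul_zero]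
  have hterm : x i * (B ^ k) i j = 0 :=
    (Finset.sum_eq_zero_iff_of_nonneg fun a _ =>
      mul_nonneg (hx a) (Matrix.pow_apply_nonneg hirr.nonneg k a j)).1 hsum i (Finset.mem_univ i)
  exact (mul_eq_zero.1 hterm).resolve_right hk.ne'

theorem vecMul_eq_smul_of_isMaxOn [Nonempty ι] (hirr : B.IsIrreducible) {x : ι → ℝ} {r : ℝ}
    (hmem : (x, r) ∈ collatzWielandt B) (hmax : IsMaxOn Prod.snd (collatzWielandt B) (x, r)) :
    x ᵥ* B = r • x := by
  classical
  obtain ⟨N, hQ⟩ := exists_sum_pow_pos hirr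
  set Q := ∑ k ∈ Finset.range N, B ^ k
  have hcomm : Q * B = B * Q :=
    (Commute.sum_left _ _ _ fun k _ => (Commute.refl B).pow_left k : Commute Q B)
  obtain ⟨hx, hr, hxr⟩ := hmem
  have hx_ne : x ≠ 0 := by
    rintro rfl
    simpa using hx.2
  by_contra hne
  -- Applying `Q` turns the nonzero defect `x B - r x ≥ 0` into a strictly positive one.
  have hstrict (j : ι) : r * (x ᵥ* Q) j < (x ᵥ* Q ᵥ* B) j := by
    have hpos := vecMul_pos_of_pos hQ (sub_nonneg.2 hxr) (sub_ne_zero.2 hne) j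
    rw [sub_vecMul, vecMul_vecMul, ← hcomm, ← vecMul_vecMul, smul_vecMul] at hpos
    simpa using hpos
  obtain ⟨w, s, hrs, hw⟩ :=
    exists_gt_mem_collatzWielandt (vecMul_pos_of_pos hQ hx.1 hx_ne) hr hstrict
  exact hrs.not_ge (hmax hw)

theorem exists_pos_vecMul_eq_smul [Nonempty ι] (hirr : B.IsIrreducible) :
    ∃ (r : ℝ) (v : ι → ℝ), (∀ i, 0 < v i) ∧ v ᵥ* B = r • v := by
  obtain ⟨⟨x, r⟩, hmem, hmax⟩ := (isCompact_collatzWielandt hirr.nonneg).exists_isMaxOn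
    (collatzWielandt_nonempty hirr.nonneg) continuous_snd.continuousOn
  have heig := vecMul_eq_smul_of_isMaxOn hirr hmem hmax
  have hx_ne : x ≠ 0 := by
    rintro rfl
    simpa using hmem.1.2
  exact ⟨r, x, pos_of_vecMul_eq_smul hirr hmem.1.1 hx_ne heig, heig⟩

theorem eq_smul_of_vecMul_eq_smul [Nonempty ι] (hirr : B.IsIrreducible) {v w : ι → ℝ} {r : ℝ}
    (hv : ∀ i, 0 < v i) (hvB : v ᵥ* B = r • v) (hwB : w ᵥ* B = r • w) :
    ∃ c : ℝ, w = c • v := by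
  obtain ⟨i₀, hi₀⟩ := Finite.exists_min fun i => w i / v i
  refine ⟨w i₀ / v i₀, sub_eq_zero.1 ?_⟩
  by_contra hne
  have hnonneg : 0 ≤ w - (w i₀ / v i₀) • v :=
    sub_nonneg.2 fun i => (le_div_iff₀ (hv i)).1 (hi₀ i)
  have hpos := pos_of_vecMul_eq_smul hirr hnonneg hne
    (by rw [sub_vecMul, smul_vecMul, hvB, hwB, smul_sub, smul_comm]) i₀
  simp [(hv i₀).ne'] at hpos

theorem exists_pos_mulVec_eq [Nonempty ι] (hirr : B.IsIrreducible) {v : ι → ℝ}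
    (hv : ∀ i, 0 < v i) (hvB : v ᵥ* B = v) : ∃ q : ι → ℝ, (∀ i, 0 < q i) ∧ B *ᵥ q = q := by
  obtain ⟨r, q, hq, hqB⟩ := exists_pos_vecMul_eq_smul hirr.transpose
  rw [vecMul_transpose] at hqB
  have hvq : 0 < v ⬝ᵥ q :=
    Finset.sum_pos (fun i _ => mul_pos (hv i) (hq i)) Finset.univ_nonempty
  have hr : r * (v ⬝ᵥ q) = v ⬝ᵥ q := by
    rw [← smul_eq_mul, ← dotProduct_smul, ← hqB, dotProduct_mulVec, hvB]
  refine ⟨q, hq, ?_⟩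
  rw [hqB, (mul_eq_right₀ hvq.ne').1 hr, one_smul]

theorem existsUnique_mulVec_eq [Nonempty ι] (hirr : B.IsIrreducible)
    (hsum : ∀ j, ∑ i, B i j = 1) : ∃! p : ι → ℝ, B *ᵥ p = p ∧ ∑ i, p i = 1 := by
  obtain ⟨r, q, hq, hqB⟩ := exists_pos_vecMul_eq_smul hirr.transpose
  have hs : 0 < ∑ i, q i := Finset.sum_pos (fun i _ => hq i) Finset.univ_nonempty
  have hr : r = 1 := by
    have htotal : ∑ i, (B *ᵥ q) i = ∑ j, q j := by
      simp only [mulVec, dotProduct]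
      rw [Finset.sum_comm]
      simp only [← Finset.sum_mul, hsum, one_mul]
    rw [← vecMul_transpose, hqB] at htotal
    simp only [Pi.smul_apply, smul_eq_mul, ← Finset.mul_sum] at htotal
    exact mul_right_cancel₀ hs.ne' (htotal.trans (one_mul _).symm)
  subst hr
  have hqB' : B *ᵥ q = q := by rw [← vecMul_transpose, hqB, one_smul]
  refine ⟨(∑ i, q i)⁻¹ • q,
    ⟨by rw [mulVec_smul, hqB'], (inv_sum_smul_mem_stdSimplex hq).2⟩, ?_⟩
  rintro p ⟨hpB, hp⟩
  obtain ⟨c, rfl⟩ := eq_smul_of_vecMul_eq_smul hirr.transpose hq hqB (w := p)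
    (by rw [vecMul_transpose, hpB, one_smul])
  simp only [Pi.smul_apply, smul_eq_mul, ← Finset.mul_sum] at hp
  rw [eq_inv_of_mul_eq_one_left hp]

end PerronFrobenius

section TracePow

variable {ι : Type*} [Fintype ι] [DecidableEq ι] {B : Matrix ι ι ℝ}

theorem sum_paths_eq_trace (B : Matrix ι ι ℝ) (n : ℕ) (K : Matrix ι ι ℝ) :
    ∑ γ : Fin (n + 1) → ι, K (γ 0) (γ (Fin.last n)) * ∏ k : Fin n, B (γ k.castSucc) (γ k.succ) =
      (Kᵀ * B ^ n).trace := by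
  induction n generalizing K with
  | zero =>
    rw [← (Equiv.funUnique (Fin 1) ι).symm.sum_comp]
    simp [trace]
  | succ n ih =>
    have hcons (γ : Fin (n + 1) → ι) : ∑ i, K i (γ (Fin.last n)) *
        ∏ k : Fin (n + 1), B (Fin.cons (α := fun _ => ι) i γ k.castSucc) (γ k) =
        (Bᵀ * K) (γ 0) (γ (Fin.last n)) * ∏ k : Fin n, B (γ k.castSucc) (γ k.succ) := by
      simp only [Fin.prod_univ_succ, mul_apply, transpose_apply, Finset.sum_mul, Fin.castSucc_zero,
        Fin.cons_zero, ← Fin.succ_castSucc, Fin.cons_succ]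
      exact Finset.sum_congr rfl fun i _ => by ring
    rw [← (Fin.consEquiv fun _ => ι).sum_comp, Fintype.sum_prod_type, Finset.sum_comm]
    refine (Finset.sum_congr rfl fun γ _ => hcons γ).trans ((ih (Bᵀ * K)).trans ?_)
    rw [transpose_mul, transpose_transpose, Matrix.mul_assoc, ← pow_succ']

theorem summable_trace_pow (hB : ∀ i j, 0 ≤ B i j) {v : ι → ℝ} (hv : ∀ i, 0 < v i) {r : ℝ}
    (hr : r < 1) (h : v ᵥ* B ≤ r • v) : Summable fun n => (B ^ n).trace := by
  have hnonneg (n : ℕ) (i j : ι) : 0 ≤ (B ^ n) i j := Matrix.pow_apply_nonneg hB n i j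
  cases isEmpty_or_nonempty ι
  · simp [trace, summable_zero]
  have hr₀ : 0 ≤ r := by
    obtain ⟨i⟩ := ‹Nonempty ι›
    have hvB : 0 ≤ (v ᵥ* B) i := Finset.sum_nonneg fun a _ => mul_nonneg (hv a).le (hB a i)
    exact nonneg_of_mul_nonneg_left (hvB.trans (h i)) (hv i)
  have hpow (n : ℕ) : v ᵥ* B ^ n ≤ r ^ n • v := by
    induction n with
    | zero => simp
    | succ n ih =>
      calc v ᵥ* B ^ (n + 1)
        _ = v ᵥ* B ^ n ᵥ* B := by rw [pow_succ, vecMul_vecMul]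
        _ ≤ (r ^ n • v) ᵥ* B := vecMul_le_vecMul hB ih
        _ = r ^ n • (v ᵥ* B) := smul_vecMul _ _ _
        _ ≤ r ^ n • r • v := smul_le_smul_of_nonneg_left h (pow_nonneg hr₀ n)
        _ = r ^ (n + 1) • v := by rw [smul_smul, pow_succ]
  have hdiag (n : ℕ) (i : ι) : (B ^ n) i i ≤ r ^ n := by
    refine le_of_mul_le_mul_left ?_ (hv i)
    calc v i * (B ^ n) i i
      _ ≤ (v ᵥ* B ^ n) i := Finset.single_le_sum (f := fun a => v a * (B ^ n) a i)
          (fun a _ => mul_nonneg (hv a).le (hnonneg n a i)) (Finset.mem_univ i)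
      _ ≤ r ^ n * v i := hpow n i
      _ = v i * r ^ n := mul_comm _ _
  exact summable_sum fun i _ => Summable.of_nonneg_of_le (fun n => hnonneg n i i)
    (fun n => hdiag n i) (summable_geometric_of_lt_one hr₀ hr)

-- A path from `i` to `j` closes up by a fixed path from `j` to `i`.
theorem summable_pow_apply (hirr : B.IsIrreducible) (h : Summable fun n => (B ^ n).trace)
    (i j : ι) : Summable fun n => (B ^ n) i j := by
  have hnonneg (n : ℕ) (i j : ι) : 0 ≤ (B ^ n) i j := Matrix.pow_apply_nonneg hirr.nonneg n i j
  obtain ⟨m, -, hm⟩ := (isIrreducible_iff_exists_pow_pos hirr.nonneg).1 hirr j i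
  have hle (n : ℕ) : (B ^ n) i j * (B ^ m) j i ≤ (B ^ (n + m)).trace := by
    calc (B ^ n) i j * (B ^ m) j i
      _ ≤ ∑ a, (B ^ n) i a * (B ^ m) a i :=
          Finset.single_le_sum (f := fun a => (B ^ n) i a * (B ^ m) a i)
            (fun a _ => mul_nonneg (hnonneg n i a) (hnonneg m a i)) (Finset.mem_univ j)
      _ = (B ^ (n + m)) i i := by rw [pow_add, mul_apply]
      _ ≤ (B ^ (n + m)).trace :=
          Finset.single_le_sum (fun a _ => hnonneg (n + m) a a) (Finset.mem_univ i)
  have hsum : Summable fun n => (B ^ n) i j * (B ^ m) j i :=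
    .of_nonneg_of_le (fun n => mul_nonneg (hnonneg n i j) (hnonneg m j i)) hle
      (h.comp_injective (add_left_injective m))
  exact (summable_mul_right_iff hm.ne').1 hsum

theorem not_summable_trace_pow [Nonempty ι] (hirr : B.IsIrreducible) {v : ι → ℝ}
    (hv : ∀ i, 0 < v i) (h : v ≤ v ᵥ* B) : ¬ Summable fun n => (B ^ n).trace := by
  intro hsum
  obtain ⟨j⟩ := ‹Nonempty ι›
  have hpow (n : ℕ) : v ≤ v ᵥ* B ^ n := by
    induction n with
    | zero => simp
    | succ n ih =>
      rw [pow_succ, ← vecMul_vecMul]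
      exact h.trans (vecMul_le_vecMul hirr.nonneg ih)
  have hzero : Tendsto (fun n => (v ᵥ* B ^ n) j) atTop (𝓝 0) :=
    (summable_sum fun i _ =>
      (summable_pow_apply hirr hsum i j).mul_left (v i)).tendsto_atTop_zero
  exact (hv j).not_ge (ge_of_tendsto' hzero fun n => hpow n j)

end TracePow

section Growth

variable {α : Type*} {S : Set α} {len : α → ℝ} {h s : ℝ}

/-- The counting function of the elements of `S` with respect to the length `len`. -/
def countBelow (S : Set α) (len : α → ℝ) (T : ℝ) : ℕ := {γ ∈ S | len γ < T}.ncard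

theorem countBelow_le_tsum (hs : 0 ≤ s)
    (hsum : Summable (S.indicator fun γ => Real.exp (-(s * len γ)))) (T : ℝ) :
    (countBelow S len T : ℝ) ≤
      (∑' γ, S.indicator (fun γ => Real.exp (-(s * len γ))) γ) * Real.exp (s * T) := by
  have hnonneg (γ : α) : 0 ≤ S.indicator (fun γ => Real.exp (-(s * len γ))) γ :=
    Set.indicator_nonneg (fun _ _ => (Real.exp_pos _).le) γ
  rcases Set.finite_or_infinite {γ ∈ S | len γ < T} with hfin | hinf
  · have hterm : ∀ γ ∈ hfin.toFinset,
        Real.exp (-(s * T)) ≤ S.indicator (fun γ => Real.exp (-(s * len γ))) γ := by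
      intro γ hγ
      obtain ⟨hγS, hγT⟩ := hfin.mem_toFinset.1 hγ
      rw [Set.indicator_of_mem hγS]
      exact Real.exp_le_exp.2 (neg_le_neg (mul_le_mul_of_nonneg_left hγT.le hs))
    rw [← div_le_iff₀ (Real.exp_pos _), div_eq_mul_inv, ← Real.exp_neg, countBelow,
      Set.ncard_eq_toFinset_card _ hfin, ← nsmul_eq_mul]
    exact (Finset.card_nsmul_le_sum _ _ _ hterm).trans (hsum.sum_le_tsum _ fun γ _ => hnonneg γ)
  · rw [countBelow, hinf.ncard, Nat.cast_zero]
    exact mul_nonneg (tsum_nonneg hnonneg) (Real.exp_pos _).le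

theorem growthRate_le_of_summable
    (hh : Tendsto (fun T : ℝ => (1 / T) * Real.log (countBelow S len T)) atTop (𝓝 h))
    (hs : 0 ≤ s) (hsum : Summable (S.indicator fun γ => Real.exp (-(s * len γ)))) : h ≤ s := by
  set C := 1 + ∑' γ, S.indicator (fun γ => Real.exp (-(s * len γ))) γ
  have hC : 1 ≤ C := le_add_of_nonneg_right
    (tsum_nonneg fun γ => Set.indicator_nonneg (fun _ _ => (Real.exp_pos _).le) γ)
  have hlog {T : ℝ} (hT : 0 < T) : Real.log (countBelow S len T) ≤ Real.log C + s * T := by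
    rcases Nat.eq_zero_or_pos (countBelow S len T) with h₀ | h₀
    · rw [h₀, Nat.cast_zero, Real.log_zero]
      exact add_nonneg (Real.log_nonneg hC) (mul_nonneg hs hT.le)
    · rw [← Real.log_exp (s * T), ← Real.log_mul (by positivity) (Real.exp_pos _).ne']
      refine Real.log_le_log (Nat.cast_pos.2 h₀) ((countBelow_le_tsum hs hsum T).trans ?_)
      gcongr
      exact le_add_of_nonneg_left zero_le_one
  have hbound : ∀ᶠ T : ℝ in atTop,
      (1 / T) * Real.log (countBelow S len T) ≤ Real.log C / T + s := by
    filter_upwards [eventually_gt_atTop 0] with T hT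
    rw [one_div_mul_eq_div, div_add' _ _ _ hT.ne']
    exact div_le_div_of_nonneg_right (hlog hT) hT.le
  have hlim : Tendsto (fun T => Real.log C / T + s) atTop (𝓝 (0 + s)) :=
    (tendsto_const_nhds.div_atTop tendsto_id).add_const s
  simpa using le_of_tendsto_of_tendsto hh hlim hbound

theorem eventually_countBelow_le_exp
    (hh : Tendsto (fun T : ℝ => (1 / T) * Real.log (countBelow S len T)) atTop (𝓝 h))
    (hlt : h < s) : ∀ᶠ T in atTop, (countBelow S len T : ℝ) ≤ Real.exp (s * T) := by
  filter_upwards [eventually_gt_atTop 0, hh.eventually (gt_mem_nhds hlt)] with T hT hlog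
  rcases Nat.eq_zero_or_pos (countBelow S len T) with h₀ | h₀
  · rw [h₀, Nat.cast_zero]
    exact (Real.exp_pos _).le
  · rw [one_div_mul_eq_div, div_lt_iff₀ hT] at hlog
    exact (Real.log_le_iff_le_exp (Nat.cast_pos.2 h₀)).1 hlog.le

theorem summable_countBelow_mul_exp
    (hh : Tendsto (fun T : ℝ => (1 / T) * Real.log (countBelow S len T)) atTop (𝓝 h))
    (hlt : h < s) :
    Summable fun k : ℕ => (countBelow S len (k + 1 : ℝ) : ℝ) * Real.exp (-(s * k)) := by
  obtain ⟨r, hr, hrs⟩ := exists_between hlt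
  have hgeom : Summable fun k : ℕ => Real.exp r * Real.exp (r - s) ^ k :=
    (summable_geometric_of_lt_one (Real.exp_pos _).le
      (Real.exp_lt_one_iff.2 (sub_neg.2 hrs))).mul_left _
  refine hgeom.of_norm_bounded_eventually_nat ?_
  have hsucc : Tendsto (fun k : ℕ => (k + 1 : ℝ)) atTop atTop :=
    tendsto_atTop_add_const_right _ _ tendsto_natCast_atTop_atTop
  filter_upwards [hsucc.eventually (eventually_countBelow_le_exp hh hr)] with k hk
  rw [Real.norm_of_nonneg (by positivity)]
  calc (countBelow S len (k + 1 : ℝ) : ℝ) * Real.exp (-(s * k))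
    _ ≤ Real.exp (r * (k + 1)) * Real.exp (-(s * k)) :=
        mul_le_mul_of_nonneg_right hk (Real.exp_pos _).le
    _ = Real.exp r * Real.exp (r - s) ^ k := by
        rw [← Real.exp_add, ← Real.exp_nat_mul, ← Real.exp_add]
        congr 1
        ring

theorem summable_exp_of_growthRate_lt (hlen : ∀ γ, 0 ≤ len γ)
    (hfin : ∀ T, {γ ∈ S | len γ < T}.Finite)
    (hh : Tendsto (fun T : ℝ => (1 / T) * Real.log (countBelow S len T)) atTop (𝓝 h))
    (hs : 0 ≤ s) (hlt : h < s) : Summable (S.indicator fun γ => Real.exp (-(s * len γ))) := by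
  classical
  refine summable_of_sum_le
    (c := ∑' k : ℕ, (countBelow S len (k + 1 : ℝ) : ℝ) * Real.exp (-(s * k)))
    (fun γ => Set.indicator_nonneg (fun _ _ => (Real.exp_pos _).le) γ) fun F => ?_
  have hblock (k : ℕ) : ∑ γ ∈ F with ⌊len γ⌋₊ = k,
      S.indicator (fun γ => Real.exp (-(s * len γ))) γ ≤
        countBelow S len (k + 1 : ℝ) * Real.exp (-(s * k)) := by
    have hle : ∀ γ ∈ {γ ∈ {γ ∈ F | ⌊len γ⌋₊ = k} | γ ∈ S},
        Real.exp (-(s * len γ)) ≤ Real.exp (-(s * k)) := by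
      intro γ hγ
      obtain ⟨⟨-, rfl⟩, -⟩ := by simpa only [Finset.mem_filter] using hγ
      exact Real.exp_le_exp.2
        (neg_le_neg (mul_le_mul_of_nonneg_left (Nat.floor_le (hlen γ)) hs))
    have hcard : {γ ∈ {γ ∈ F | ⌊len γ⌋₊ = k} | γ ∈ S}.card ≤ countBelow S len (k + 1 : ℝ) := by
      rw [countBelow, ← Set.ncard_coe_finset]
      refine Set.ncard_le_ncard (fun γ hγ => ?_) (hfin _)
      obtain ⟨⟨-, rfl⟩, hγS⟩ := by simpa only [Finset.coe_filter, Finset.mem_filter] using hγ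
      exact ⟨hγS, Nat.lt_floor_add_one _⟩
    simp only [Set.indicator_apply, ← Finset.sum_filter]
    exact (Finset.sum_le_card_nsmul _ _ _ hle).trans_eq (nsmul_eq_mul _ _) |>.trans
      (mul_le_mul_of_nonneg_right (Nat.cast_le.2 hcard) (Real.exp_pos _).le)
  rw [← Finset.sum_fiberwise_of_maps_to (t := F.image fun γ => ⌊len γ⌋₊)
    fun γ hγ => Finset.mem_image_of_mem _ hγ]
  exact (Finset.sum_le_sum fun k _ => hblock k).trans
    ((summable_countBelow_mul_exp hh hlt).sum_le_tsum _ fun k _ => by positivity)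

end Growth

namespace UGraph

variable {V E : Type*} (G : UGraph V E)

/-- The closed cycles of all lengths, presented as in `UGraph.closedCycles`. -/
def closedWords : Set (Σ n : ℕ, Fin (n + 1) → DirEdge E) :=
  {γ | 1 ≤ γ.1 ∧ γ.2 (Fin.last γ.1) = γ.2 0 ∧
    ∀ i : Fin γ.1, G.adj (γ.2 i.castSucc) (γ.2 i.succ) = 1}

/-- The length `l(γ)` of a cycle; its final edge, which repeats the first one, is not counted. -/
def wordLength (l : E → ℝ) (γ : Σ n : ℕ, Fin (n + 1) → DirEdge E) : ℝ :=
  ∑ i : Fin γ.1, l (γ.2 i.castSucc).edge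

variable {G}

theorem closedCycles_eq (l : E → ℝ) (T : ℝ) :
    G.closedCycles l T = {γ ∈ G.closedWords | wordLength l γ < T} := by
  ext γ
  simp only [closedCycles, closedWords, wordLength, Set.mem_ofPred_eq, and_assoc]

theorem HasEntropy.tendsto_countBelow {l : E → ℝ} {h : ℝ} (hh : G.HasEntropy l h) :
    Tendsto (fun T : ℝ => (1 / T) * Real.log (countBelow G.closedWords (wordLength l) T))
      atTop (𝓝 h) := by
  simpa only [HasEntropy, closedCycles_eq, countBelow] using hh

theorem finite_wordLength_lt [Finite E] {l : E → ℝ} (hl : ∀ e, 0 < l e) (T : ℝ) :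
    {γ | wordLength l γ < T}.Finite := by
  obtain ⟨a, ha, hal⟩ : ∃ a > 0, ∀ e, a ≤ l e := by
    cases isEmpty_or_nonempty E
    · exact ⟨1, one_pos, fun e => isEmptyElim e⟩
    · obtain ⟨e, he⟩ := Finite.exists_min l
      exact ⟨l e, hl e, he⟩
  obtain ⟨M, hM⟩ := exists_nat_gt (T / a)
  have hlen : ∀ γ ∈ {γ | wordLength l γ < T}, γ.1 < M := by
    intro γ hγ
    have hlower : (γ.1 : ℝ) * a ≤ wordLength l γ := by
      simpa [wordLength] using Finset.card_nsmul_le_sum Finset.univ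
        (fun i : Fin γ.1 => l (γ.2 i.castSucc).edge) a fun i _ => hal _
    have hupper : T < M * a := (div_lt_iff₀ ha).1 hM
    exact_mod_cast lt_of_mul_lt_mul_right (hlower.trans_lt (lt_trans hγ hupper)) ha.le
  refine ((Set.finite_Iio M).biUnion fun n _ => Set.finite_range (Sigma.mk n)).subset ?_
  exact fun γ hγ => Set.mem_biUnion (Set.mem_Iio.2 (hlen γ hγ)) ⟨γ.2, rfl⟩

theorem weighted_nonneg (l : E → ℝ) (i j : DirEdge E) : 0 ≤ G.weighted l i j :=
  mul_nonneg (G.adj_nonneg i j) (Real.exp_pos _).le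

theorem weighted_pos {l : E → ℝ} {i j : DirEdge E} (h : G.adj i j = 1) :
    0 < G.weighted l i j := by
  rw [weighted, h, one_mul]
  exact Real.exp_pos _

open Classical in
theorem trace_weighted_pow [Fintype E] (l : E → ℝ) (n : ℕ) :
    (G.weighted l ^ (n + 1)).trace =
      ∑ γ, G.closedWords.indicator (fun γ => Real.exp (-wordLength l γ)) ⟨n + 1, γ⟩ := by
  have hpaths := sum_paths_eq_trace (G.weighted l) (n + 1) 1
  rw [transpose_one, Matrix.one_mul] at hpaths
  rw [← hpaths]
  refine Finset.sum_congr rfl fun γ _ => ?_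
  by_cases hclosed : γ (Fin.last (n + 1)) = γ 0
  · rw [hclosed, one_apply_eq, one_mul]
    by_cases hadj : ∀ i : Fin (n + 1), G.adj (γ i.castSucc) (γ i.succ) = 1
    · have hmem : (⟨n + 1, γ⟩ : Σ n : ℕ, Fin (n + 1) → DirEdge E) ∈ G.closedWords :=
        ⟨Nat.le_add_left 1 n, hclosed, hadj⟩
      rw [Set.indicator_of_mem hmem, wordLength,
        ← Finset.sum_neg_distrib, Real.exp_sum]
      exact Finset.prod_congr rfl fun i _ => by rw [weighted, hadj, one_mul]
    · rw [Set.indicator_of_notMem fun h => hadj h.2.2]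
      obtain ⟨i, hi⟩ := not_forall.1 hadj
      refine Finset.prod_eq_zero (Finset.mem_univ i) ?_
      rw [weighted, (G.adj_eq_zero_or_one _ _).resolve_right hi, zero_mul]
  · rw [one_apply_ne (Ne.symm hclosed), zero_mul, Set.indicator_of_notMem fun h => hclosed h.2.1]

open Classical in
theorem summable_closedWords_iff [Fintype E] (l : E → ℝ) :
    Summable (G.closedWords.indicator fun γ => Real.exp (-wordLength l γ)) ↔
      Summable fun n => (G.weighted l ^ n).trace := by
  rw [summable_sigma_of_nonneg fun γ => Set.indicator_nonneg (fun _ _ => (Real.exp_pos _).le) γ,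
    and_iff_right fun n => Summable.of_finite, ← summable_nat_add_iff 1,
    ← summable_nat_add_iff (f := fun n => (G.weighted l ^ n).trace) 1]
  simp only [tsum_fintype, trace_weighted_pow]

theorem wordLength_smul (s : ℝ) (l : E → ℝ) (γ : Σ n : ℕ, Fin (n + 1) → DirEdge E) :
    wordLength (s • l) γ = s * wordLength l γ := by
  simp only [wordLength, Pi.smul_apply, smul_eq_mul, Finset.mul_sum]

theorem HasEntropy.le_of_vecMul_le [Fintype E] {l : E → ℝ} {h s r : ℝ} (hh : G.HasEntropy l h)
    (hs : 0 ≤ s) (hr : r < 1) {v : DirEdge E → ℝ} (hv : ∀ i, 0 < v i)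
    (hvr : v ᵥ* G.weighted (s • l) ≤ r • v) : h ≤ s := by
  classical
  refine growthRate_le_of_summable hh.tendsto_countBelow hs ?_
  simpa only [wordLength_smul] using
    (summable_closedWords_iff (s • l)).2 (summable_trace_pow (weighted_nonneg _) hv hr hvr)

theorem weighted_isIrreducible
    (hadj : ∀ i j, Relation.TransGen (fun a b => G.adj a b = 1) i j) (l : E → ℝ) :
    (G.weighted l).IsIrreducible :=
  isIrreducible_of_transGen (weighted_nonneg l) fun i j =>
    Relation.TransGen.mono (fun _ _ => weighted_pos) i j (hadj i j)

theorem HasEntropy.le_of_le_vecMul [Fintype E] [Nonempty (DirEdge E)]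
    (hadj : ∀ i j, Relation.TransGen (fun a b => G.adj a b = 1) i j) {l : E → ℝ}
    (hl : ∀ e, 0 < l e) {h s : ℝ} (hh : G.HasEntropy l h) (hs : 0 ≤ s) {v : DirEdge E → ℝ}
    (hv : ∀ i, 0 < v i) (hvr : v ≤ v ᵥ* G.weighted (s • l)) : s ≤ h := by
  classical
  by_contra! hlt
  refine not_summable_trace_pow (weighted_isIrreducible hadj (s • l)) hv hvr ?_
  rw [← summable_closedWords_iff]
  simp only [wordLength_smul]
  exact summable_exp_of_growthRate_lt (fun γ => Finset.sum_nonneg fun i _ => (hl _).le)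
    (fun T => (finite_wordLength_lt hl T).subset fun γ hγ => hγ.2) hh.tendsto_countBelow hs hlt

theorem weighted_smul (l : E → ℝ) (s : ℝ) (i j : DirEdge E) :
    G.weighted (s • l) i j = Real.exp ((1 - s) * l i.edge) * G.weighted l i j := by
  simp only [weighted, Pi.smul_apply, smul_eq_mul]
  rw [mul_left_comm, ← Real.exp_add]
  congr 2
  ring

theorem vecMul_weighted_smul_le [Fintype E] {l : E → ℝ} {L s r : ℝ} (hL : ∀ e, l e ≤ L)
    (hs : s ≤ 1) {v : DirEdge E → ℝ} (hv : ∀ i, 0 < v i) (hvr : v ᵥ* G.weighted l = r • v) :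
    v ᵥ* G.weighted (s • l) ≤ (Real.exp ((1 - s) * L) * r) • v := by
  rw [mul_smul, ← hvr, ← vecMul_smul]
  refine fun j => Finset.sum_le_sum fun i _ => mul_le_mul_of_nonneg_left ?_ (hv i).le
  change G.weighted (s • l) i j ≤ Real.exp ((1 - s) * L) * G.weighted l i j
  rw [weighted_smul]
  exact mul_le_mul_of_nonneg_right (Real.exp_le_exp.2
    (mul_le_mul_of_nonneg_left (hL i.edge) (sub_nonneg.2 hs))) (weighted_nonneg l i j)

theorem le_vecMul_weighted_smul [Fintype E] {l : E → ℝ} {L s r : ℝ} (hL : ∀ e, l e ≤ L)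
    (hs : 1 ≤ s) {v : DirEdge E → ℝ} (hv : ∀ i, 0 < v i) (hvr : v ᵥ* G.weighted l = r • v) :
    (Real.exp ((1 - s) * L) * r) • v ≤ v ᵥ* G.weighted (s • l) := by
  rw [mul_smul, ← hvr, ← vecMul_smul]
  refine fun j => Finset.sum_le_sum fun i _ => mul_le_mul_of_nonneg_left ?_ (hv i).le
  change Real.exp ((1 - s) * L) * G.weighted l i j ≤ G.weighted (s • l) i j
  rw [weighted_smul]
  exact mul_le_mul_of_nonneg_right (Real.exp_le_exp.2
    (mul_le_mul_of_nonpos_left (hL i.edge) (sub_nonpos.2 hs))) (weighted_nonneg l i j)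

theorem eigenvalue_eq_one [Fintype E] [Nonempty (DirEdge E)]
    (hadj : ∀ i j, Relation.TransGen (fun a b => G.adj a b = 1) i j) {l : E → ℝ}
    (hl : l ∈ G.entropyOne) {r : ℝ} {v : DirEdge E → ℝ} (hv : ∀ i, 0 < v i)
    (hvr : v ᵥ* G.weighted l = r • v) : r = 1 := by
  obtain ⟨L, hL⟩ : ∃ L, ∀ e, l e ≤ L := by
    obtain ⟨L, hL⟩ := (Set.finite_range l).bddAbove
    exact ⟨L, fun e => hL ⟨e, rfl⟩⟩
  have hcont : Tendsto (fun s : ℝ => Real.exp ((1 - s) * L) * r) (𝓝 1) (𝓝 r) := by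
    have : Continuous fun s : ℝ => Real.exp ((1 - s) * L) * r := by fun_prop
    simpa using this.tendsto 1
  rcases lt_trichotomy r 1 with h | h | h
  · obtain ⟨s, hsr, hs₀, hs₁⟩ := (((hcont.eventually (gt_mem_nhds h)).filter_mono
      nhdsWithin_le_nhds).and (Ioo_mem_nhdsLT (zero_lt_one' ℝ))).exists
    exact absurd (hl.2.le_of_vecMul_le hs₀.le hsr hv
      (vecMul_weighted_smul_le hL hs₁.le hv hvr)) hs₁.not_ge
  · exact h
  · obtain ⟨s, hsr, hs₁ : 1 < s⟩ := (((hcont.eventually (lt_mem_nhds h)).filter_mono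
      nhdsWithin_le_nhds).and (self_mem_nhdsWithin (s := Set.Ioi 1))).exists
    refine absurd (hl.2.le_of_le_vecMul hadj hl.1 (zero_le_one.trans hs₁.le) hv ?_) hs₁.not_ge
    exact le_trans (fun i => le_mul_of_one_le_left (hv i).le hsr.le)
      (le_vecMul_weighted_smul hL hs₁.le hv hvr)

end UGraph

section CompactSpace

variable {X : Type*} [TopologicalSpace X] [CompactSpace X]

theorem exists_map_apply_le [Nonempty X] {T : C(X, ℝ) →ₗ[ℝ] C(X, ℝ)} (hT : ∀ φ, 0 ≤ φ → 0 ≤ T φ)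
    (hone : T 1 = 1) (φ : C(X, ℝ)) : ∃ x, T φ x ≤ φ x := by
  obtain ⟨x, -, hx⟩ :=
    isCompact_univ.exists_isMaxOn Set.univ_nonempty φ.continuous.continuousOn
  have hle : 0 ≤ φ x • (1 : C(X, ℝ)) - φ := fun y => by simpa using hx (Set.mem_univ y)
  refine ⟨x, ?_⟩
  simpa [map_sub, map_smul, hone] using hT _ hle x

theorem exists_invariant_functional [Nonempty X] {T : C(X, ℝ) →ₗ[ℝ] C(X, ℝ)}
    (hT : ∀ φ, 0 ≤ φ → 0 ≤ T φ) (hone : T 1 = 1) :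
    ∃ Λ : C(X, ℝ) →ₗ[ℝ] ℝ, (∀ φ, 0 ≤ φ → 0 ≤ Λ φ) ∧ Λ 1 = 1 ∧ ∀ φ, Λ (T φ) = Λ φ := by
  have hone_mem : (1 : C(X, ℝ)) ∉ LinearMap.range (T - LinearMap.id) := by
    rintro ⟨φ, hφ⟩
    obtain ⟨x, hx⟩ := exists_map_apply_le hT hone φ
    have : T φ x - φ x = 1 := congrArg (fun ψ : C(X, ℝ) => ψ x) hφ
    linarith
  -- `Λ` extends the functional `T φ - φ + c ↦ c`, which is positive because `T φ - φ` takes a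
  -- nonpositive value.
  let Λ₀ : C(X, ℝ) →ₗ.[ℝ] ℝ :=
    LinearPMap.supSpanSingleton ⟨LinearMap.range (T - LinearMap.id), 0⟩ 1 1 hone_mem
  have hΛ₀ (φ : C(X, ℝ)) (c : ℝ) :
      ∃ h : (T φ - φ) + c • (1 : C(X, ℝ)) ∈ Λ₀.domain, Λ₀ ⟨_, h⟩ = c :=
    ⟨Submodule.add_mem_sup ⟨φ, rfl⟩ (Submodule.smul_mem _ _ (Submodule.mem_span_singleton_self _)),
      (LinearPMap.supSpanSingleton_apply_mk ⟨LinearMap.range (T - LinearMap.id), 0⟩ _ _ hone_mem _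
        ⟨φ, rfl⟩ c).trans (by simp)⟩
  have hnonneg (ψ : Λ₀.domain) (hψ : 0 ≤ (ψ : C(X, ℝ))) : 0 ≤ Λ₀ ψ := by
    obtain ⟨ψ, hmem⟩ := ψ
    obtain ⟨_, ⟨φ, rfl⟩, _, hc, rfl⟩ := Submodule.mem_sup.1 hmem
    obtain ⟨c, rfl⟩ := Submodule.mem_span_singleton.1 hc
    obtain ⟨x, hx⟩ := exists_map_apply_le hT hone φ
    obtain ⟨h, hval⟩ := hΛ₀ φ c
    have hx' : 0 ≤ T φ x - φ x + c := by simpa using hψ x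
    exact (show 0 ≤ c by linarith).trans_eq hval.symm
  have hdense (φ : C(X, ℝ)) : ∃ ψ : Λ₀.domain, 0 ≤ (ψ : C(X, ℝ)) + φ := by
    obtain ⟨h, -⟩ := hΛ₀ 0 ‖φ‖
    refine ⟨⟨_, h⟩, fun x => ?_⟩
    simpa using neg_le_iff_add_nonneg'.1 (neg_le_of_abs_le (φ.norm_coe_le_norm x))
  obtain ⟨Λ, hΛ, hpos⟩ := riesz_extension (PointedCone.positive ℝ C(X, ℝ)) Λ₀ hnonneg hdense
  have hval (φ : C(X, ℝ)) (c : ℝ) : Λ ((T φ - φ) + c • (1 : C(X, ℝ))) = c := by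
    obtain ⟨h, hc⟩ := hΛ₀ φ c
    exact (hΛ ⟨_, h⟩).trans hc
  exact ⟨Λ, hpos, by simpa using hval 0 1,
    fun φ => sub_eq_zero.1 (by simpa using hval φ 0)⟩

variable [MeasurableSpace X] [BorelSpace X]

theorem exists_probabilityMeasure_integral_eq [T2Space X] {Λ : C(X, ℝ) →ₗ[ℝ] ℝ}
    (hΛ : ∀ φ, 0 ≤ φ → 0 ≤ Λ φ) (hone : Λ 1 = 1) :
    ∃ m : Measure X, IsProbabilityMeasure m ∧ ∀ φ : C(X, ℝ), ∫ x, φ x ∂m = Λ φ := by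
  let Λ' : CompactlySupportedContinuousMap X ℝ →ₚ[ℝ] ℝ :=
    { toFun := fun φ => Λ φ.toContinuousMap
      map_add' := fun φ ψ => map_add Λ φ.toContinuousMap ψ.toContinuousMap
      map_smul' := fun c φ => map_smul Λ c φ.toContinuousMap
      monotone' := fun φ ψ h => by
        have hsub := hΛ (ψ.toContinuousMap - φ.toContinuousMap) fun x => sub_nonneg.2 (h x)
        rwa [map_sub, sub_nonneg] at hsub }
  have hint (φ : C(X, ℝ)) : ∫ x, φ x ∂(RealRMK.rieszMeasure Λ') = Λ φ :=
    RealRMK.integral_rieszMeasure Λ' ⟨φ, HasCompactSupport.of_compactSpace _⟩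
  have hmass := hint 1
  simp only [hone, ContinuousMap.one_apply, integral_const, smul_eq_mul, mul_one,
    Measure.real] at hmass
  exact ⟨_, ⟨(ENNReal.toReal_eq_one_iff _).1 hmass⟩, hint⟩

theorem exists_invariant_probabilityMeasure [T2Space X] [Nonempty X]
    {T : C(X, ℝ) →ₗ[ℝ] C(X, ℝ)} (hT : ∀ φ, 0 ≤ φ → 0 ≤ T φ) (hone : T 1 = 1) :
    ∃ m : Measure X, IsProbabilityMeasure m ∧ ∀ φ : C(X, ℝ), ∫ x, T φ x ∂m = ∫ x, φ x ∂m := by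
  obtain ⟨Λ, hpos, hΛ, hinv⟩ := exists_invariant_functional hT hone
  obtain ⟨m, hm, hint⟩ := exists_probabilityMeasure_integral_eq hpos hΛ
  exact ⟨m, hm, fun φ => by rw [hint, hint, hinv]⟩

theorem integrable_continuousMap (m : Measure X) [IsFiniteMeasure m] (f : C(X, ℝ)) :
    Integrable f m :=
  f.continuous.integrable_of_hasCompactSupport (HasCompactSupport.of_compactSpace _)

/-- The probability measure with density proportional to `v`. -/
def normalizedDensity (v : X → ℝ) (μ : Measure X) : Measure X :=
  (ENNReal.ofReal (∫ x, v x ∂μ))⁻¹ • μ.withDensity fun x => ENNReal.ofReal (v x)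

variable {μ : Measure X} [IsProbabilityMeasure μ] {v : C(X, ℝ)}

theorem integral_pos_of_continuousMap (hv : ∀ x, 0 < v x) : 0 < ∫ x, v x ∂μ := by
  have hsupp : Function.support v = Set.univ := by
    ext x
    simp [(hv x).ne']
  rw [integral_pos_iff_support_of_nonneg (fun x => (hv x).le) (integrable_continuousMap μ v),
    hsupp, measure_univ]
  exact one_pos

theorem isProbabilityMeasure_normalizedDensity (hv : ∀ x, 0 < v x) :
    IsProbabilityMeasure (normalizedDensity v μ) := by
  constructor
  rw [normalizedDensity, Measure.smul_apply, withDensity_apply _ MeasurableSet.univ,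
    Measure.restrict_univ, ← ofReal_integral_eq_lintegral_ofReal (integrable_continuousMap μ v)
      (ae_of_all _ fun x => (hv x).le), smul_eq_mul]
  exact ENNReal.inv_mul_cancel (by simpa using integral_pos_of_continuousMap hv)
    ENNReal.ofReal_ne_top

theorem integral_normalizedDensity (hv : ∀ x, 0 < v x) (φ : X → ℝ) :
    ∫ x, φ x ∂(normalizedDensity v μ) = (∫ x, v x ∂μ)⁻¹ * ∫ x, v x * φ x ∂μ := by
  rw [normalizedDensity, integral_smul_measure,
    integral_withDensity_eq_integral_toReal_smul v.continuous.measurable.ennreal_ofReal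
      (ae_of_all _ fun x => ENNReal.ofReal_lt_top), ENNReal.toReal_inv,
    ENNReal.toReal_ofReal (integral_pos_of_continuousMap hv).le]
  simp only [smul_eq_mul, ENNReal.toReal_ofReal (hv _).le]

theorem normalizedDensity_normalizedDensity [HasOuterApproxClosed X] {w : C(X, ℝ)}
    (hv : ∀ x, 0 < v x) (hw : ∀ x, 0 < w x) (hwv : w * v = 1) :
    normalizedDensity v (normalizedDensity w μ) = μ := by
  have hwv' (x : X) : w x * v x = 1 := congrArg (fun φ : C(X, ℝ) => φ x) hwv
  have := isProbabilityMeasure_normalizedDensity (μ := μ) hw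
  have := isProbabilityMeasure_normalizedDensity (μ := normalizedDensity w μ) hv
  refine ext_of_forall_integral_eq_of_IsFiniteMeasure fun φ => ?_
  have hne := (integral_pos_of_continuousMap (μ := μ) hw).ne'
  simp only [integral_normalizedDensity hv, integral_normalizedDensity hw, ← mul_assoc, hwv',
    one_mul, integral_const, probReal_univ, smul_eq_mul, mul_one, inv_inv, mul_inv_cancel₀ hne]

end CompactSpace

namespace SFT

section Basic

variable {ι : Type*} {A : Matrix ι ι ℝ}

theorem continuous_coord [TopologicalSpace ι] (n : ℕ) : Continuous fun x : SFT A => x n :=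
  (continuous_apply n).comp continuous_subtype_val

theorem continuous_shift [TopologicalSpace ι] : Continuous (shift : SFT A → SFT A) :=
  Continuous.subtype_mk (continuous_pi fun n => continuous_coord (n + 1)) _

variable [TopologicalSpace ι] [DiscreteTopology ι]

theorem isClosed_range : IsClosed {x : ℕ → ι | ∀ n, A (x n) (x (n + 1)) = 1} := by
  rw [Set.ofPred_forall]
  have hcont (n : ℕ) : Continuous fun x : ℕ → ι => A (x n) (x (n + 1)) :=
    (continuous_of_discreteTopology (f := fun z : ι × ι => A z.1 z.2)).comp
      (Continuous.prodMk (f := fun x : ℕ → ι => x n) (continuous_apply n)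
        (continuous_apply (n + 1)))
  exact isClosed_iInter fun n => isClosed_eq (hcont n) continuous_const

instance [Finite ι] : CompactSpace (SFT A) :=
  isCompact_iff_compactSpace.1 isClosed_range.isCompact

instance [Finite ι] : PolishSpace (SFT A) :=
  have : SecondCountableTopology ι := inferInstance
  isClosed_range.polishSpace

/-- The continuous function `x ↦ ψ (x₀, x₁)`. -/
def cyl₂ (ψ : ι → ι → ℝ) : C(SFT A, ℝ) where
  toFun x := ψ (x 0) (x 1)
  continuous_toFun := (continuous_of_discreteTopology (f := fun z : ι × ι => ψ z.1 z.2)).comp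
    ((continuous_coord 0).prodMk (continuous_coord 1))

/-- The continuous function `x ↦ ψ (x₀)`. -/
def cyl₁ (ψ : ι → ℝ) : C(SFT A, ℝ) := cyl₂ fun i _ => ψ i

theorem cyl₂_apply (ψ : ι → ι → ℝ) (x : SFT A) : cyl₂ ψ x = ψ (x 0) (x 1) := rfl

theorem cyl₁_apply (ψ : ι → ℝ) (x : SFT A) : cyl₁ ψ x = ψ (x 0) := rfl

end Basic

section Cons

variable {ι : Type*} {A : Matrix ι ι ℝ} {i : ι} {x : SFT A}

open Classical in
/-- The sequence `i x₀ x₁ …`, or `x` itself if the transition from `i` to `x₀` is not allowed. -/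
def cons (i : ι) (x : SFT A) : SFT A :=
  if h : A i (x 0) = 1 then
    ⟨fun n => Nat.casesOn n i x.1, fun n => by cases n; exacts [h, x.2 _]⟩
  else x

open Classical in
theorem cons_apply (i : ι) (x : SFT A) (n : ℕ) :
    cons i x n = if A i (x 0) = 1 then Nat.casesOn n i x.1 else x n := by
  by_cases h : A i (x 0) = 1
  · exact (congrArg (fun y : SFT A => y n) (dif_pos h)).trans (if_pos h).symm
  · exact (congrArg (fun y : SFT A => y n) (dif_neg h)).trans (if_neg h).symm

theorem cons_zero (h : A i (x 0) = 1) : cons i x 0 = i :=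
  (cons_apply i x 0).trans (if_pos h)

theorem cons_succ (h : A i (x 0) = 1) (n : ℕ) : cons i x (n + 1) = x n :=
  (cons_apply i x (n + 1)).trans (if_pos h)

theorem shift_cons (h : A i (x 0) = 1) : shift (cons i x) = x :=
  Subtype.ext (funext fun n => cons_succ h n)

theorem cons_shift (x : SFT A) : cons (x 0) (shift x) = x := by
  have h : A (x 0) (shift x 0) = 1 := x.2 0
  refine Subtype.ext (funext fun n => ?_)
  cases n with
  | zero => exact cons_zero h
  | succ n => exact cons_succ h n

theorem continuous_cons [TopologicalSpace ι] [DiscreteTopology ι] (i : ι) :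
    Continuous (cons i : SFT A → SFT A) := by
  classical
  refine continuous_induced_rng.2 (continuous_pi fun n => ?_)
  let φ (z : ι × ι × ι) : ι := if A i z.1 = 1 then Nat.casesOn n i fun _ => z.2.1 else z.2.2
  have hφ : Continuous fun x : SFT A => φ (x 0, x (n - 1), x n) :=
    (continuous_of_discreteTopology (f := φ)).comp
      ((continuous_coord 0).prodMk ((continuous_coord (n - 1)).prodMk (continuous_coord n)))
  refine hφ.congr fun x => ?_
  cases n <;> exact (cons_apply i x _).symm

open Classical in
theorem transfer_eq_sum [Fintype ι] (f w : SFT A → ℝ) (x : SFT A) :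
    transfer f w x = ∑ i with A i (x 0) = 1, Real.exp (f (cons i x)) * w (cons i x) := by
  have hcons {i : ι} (hi : i ∈ ({i | A i (x 0) = 1} : Finset ι)) : A i (x 0) = 1 := by
    simpa using hi
  rw [← finsum_mem_coe_finset]
  refine (finsum_mem_eq_of_bijOn (fun i => cons i x) ⟨?_, ?_, ?_⟩ fun i _ => rfl).symm
  · exact fun i hi => shift_cons (hcons hi)
  · intro i hi j hj hij
    rw [← cons_zero (hcons hi), ← cons_zero (hcons hj)]
    exact congrArg (fun y : SFT A => y 0) hij
  · rintro y rfl
    exact ⟨y 0, Finset.mem_coe.2 (Finset.mem_filter.2 ⟨Finset.mem_univ _, y.2 0⟩), cons_shift y⟩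

end Cons

section Cylinder

variable {ι : Type*} {A : Matrix ι ι ℝ} [Finite ι] [TopologicalSpace ι] [DiscreteTopology ι]

open BoundedContinuousFunction in
/-- The continuous functions that depend on finitely many coordinates. -/
def cylinderFunctions (A : Matrix ι ι ℝ) : StarSubalgebra ℝ (SFT A →ᵇ ℝ) where
  carrier := {φ | ∃ n, ∀ x y : SFT A, (∀ k ≤ n, x k = y k) → φ x = φ y}
  mul_mem' := by
    rintro φ ψ ⟨n, hn⟩ ⟨k, hk⟩
    exact ⟨max n k, fun x y h => congrArg₂ (· * ·)
      (hn x y fun a ha => h a (le_max_of_le_left ha))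
      (hk x y fun a ha => h a (le_max_of_le_right ha))⟩
  add_mem' := by
    rintro φ ψ ⟨n, hn⟩ ⟨k, hk⟩
    exact ⟨max n k, fun x y h => congrArg₂ (· + ·)
      (hn x y fun a ha => h a (le_max_of_le_left ha))
      (hk x y fun a ha => h a (le_max_of_le_right ha))⟩
  algebraMap_mem' _ := ⟨0, fun _ _ _ => rfl⟩
  star_mem' := id

theorem ext_of_integral_cylinder_eq {m m' : Measure (SFT A)} [IsFiniteMeasure m]
    [IsFiniteMeasure m']
    (h : ∀ (n : ℕ) (φ : C(SFT A, ℝ)), (∀ x y : SFT A, (∀ k ≤ n, x k = y k) → φ x = φ y) →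
      ∫ x, φ x ∂m = ∫ x, φ x ∂m') : m = m' := by
  classical
  refine ext_of_forall_mem_subalgebra_integral_eq_of_polish (A := cylinderFunctions A) ?_
    fun φ ⟨n, hn⟩ => h n φ.toContinuousMap hn
  intro x y hxy
  obtain ⟨n, hn⟩ : ∃ n, x n ≠ y n := by
    by_contra! h
    exact hxy (Subtype.ext (funext h))
  let φ : C(SFT A, ℝ) := ⟨fun z => if z n = x n then 1 else 0,
    (continuous_of_discreteTopology (f := fun a => if a = x n then (1 : ℝ) else 0)).comp
      (continuous_coord n)⟩
  refine ⟨φ, ⟨_, ⟨.mkOfCompact φ, ⟨n, fun z w h => ?_⟩, rfl⟩, rfl⟩, ?_⟩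
  · simp [φ, h n le_rfl]
  · simp [φ, hn.symm]

end Cylinder

end SFT

/-- The exponential of a continuous function. -/
def expMap {X : Type*} [TopologicalSpace X] (h : C(X, ℝ)) : C(X, ℝ) :=
  ⟨fun x => Real.exp (h x), by fun_prop⟩

theorem expMap_apply {X : Type*} [TopologicalSpace X] (h : C(X, ℝ)) (x : X) :
    expMap h x = Real.exp (h x) := rfl

theorem expMap_neg_mul_self {X : Type*} [TopologicalSpace X] (h : C(X, ℝ)) :
    expMap (-h) * expMap h = 1 := by
  ext x
  simp [expMap_apply, ← Real.exp_add]

namespace SFT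

section Markov

variable {ι : Type*} [Fintype ι] {A P : Matrix ι ι ℝ}

/-- `P` is an irreducible column-stochastic matrix whose positive entries are exactly the
transitions allowed by `A`. -/
structure IsMarkov (A P : Matrix ι ι ℝ) : Prop where
  nonneg : ∀ i j, 0 ≤ P i j
  pos_iff : ∀ i j, 0 < P i j ↔ A i j = 1
  sum_col : ∀ j, ∑ i, P i j = 1
  transGen : ∀ i j, Relation.TransGen (fun a b => A a b = 1) i j

theorem IsMarkov.isIrreducible (hP : IsMarkov A P) : P.IsIrreducible :=
  isIrreducible_of_transGen hP.nonneg fun i j => by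
    simpa only [hP.pos_iff] using hP.transGen i j

theorem IsMarkov.mul_congr (hP : IsMarkov A P) {i j : ι} {a b : ℝ} (h : A i j = 1 → a = b) :
    P i j * a = P i j * b := by
  rcases (hP.nonneg i j).eq_or_lt with h0 | hpos
  · rw [← h0, zero_mul, zero_mul]
  · rw [h ((hP.pos_iff i j).1 hpos)]

theorem IsMarkov.exists_zero_eq (hP : IsMarkov A P) (i : ι) : ∃ x : SFT A, x 0 = i := by
  have hsucc (i : ι) : ∃ j, A i j = 1 :=
    let ⟨j, hj, _⟩ := Relation.TransGen.head'_iff.1 (hP.transGen i i)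
    ⟨j, hj⟩
  choose s hs using hsucc
  have hiter (n : ℕ) : A (s^[n] i) (s^[n + 1] i) = 1 := by
    rw [Function.iterate_succ_apply']
    exact hs _
  exact ⟨⟨fun n => s^[n] i, hiter⟩, rfl⟩

theorem IsMarkov.nonempty [Nonempty ι] (hP : IsMarkov A P) : Nonempty (SFT A) :=
  let ⟨x, _⟩ := hP.exists_zero_eq (Classical.arbitrary ι)
  ⟨x⟩

theorem IsMarkov.exists_mem_agree (hP : IsMarkov A P) {S : Set (SFT A)} (hne : S.Nonempty)
    (hS : ∀ x ∈ S, ∀ i, A i (x 0) = 1 → cons i x ∈ S) (n : ℕ) (y : SFT A) :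
    ∃ x ∈ S, ∀ k ≤ n, x k = y k := by
  induction n generalizing y with
  | zero =>
    obtain ⟨x₀, hx₀⟩ := hne
    suffices h : ∀ i, ∃ x ∈ S, x 0 = i by simpa using h (y 0)
    intro i
    induction hP.transGen i (x₀ 0) using Relation.TransGen.head_induction_on with
    | single h => exact ⟨cons _ x₀, hS x₀ hx₀ _ h, cons_zero h⟩
    | head h _ ih =>
      obtain ⟨x, hx, rfl⟩ := ih
      exact ⟨cons _ x, hS x hx _ h, cons_zero h⟩
  | succ n ih =>
    obtain ⟨x, hx, hxy⟩ := ih (shift y)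
    have hA : A (y 0) (x 0) = 1 := by
      rw [hxy 0 n.zero_le]
      exact y.2 0
    refine ⟨cons (y 0) x, hS x hx _ hA, fun k hk => ?_⟩
    cases k with
    | zero => exact cons_zero hA
    | succ k => exact (cons_succ hA k).trans (hxy k (Nat.le_of_succ_le_succ hk))

theorem IsMarkov.dense_of_cons_mem [TopologicalSpace ι] (hP : IsMarkov A P) {S : Set (SFT A)}
    (hne : S.Nonempty) (hS : ∀ x ∈ S, ∀ i, A i (x 0) = 1 → cons i x ∈ S) : Dense S := by
  intro y
  choose x hx hxy using fun n => hP.exists_mem_agree hne hS n y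
  have hlim : Tendsto x atTop (𝓝 y) := by
    refine tendsto_subtype_rng.2 (tendsto_pi_nhds.2 fun k => tendsto_const_nhds.congr' ?_)
    filter_upwards [eventually_ge_atTop k] with n hn
    exact (hxy n k hn).symm
  exact mem_closure_of_tendsto hlim (Eventually.of_forall hx)

variable [TopologicalSpace ι] [DiscreteTopology ι]

/-- The averaging operator `φ ↦ (x ↦ ∑ᵢ P (i, x₀) φ (i x₀ x₁ …))`, which is the transfer operator
of `markovPotential P`. -/
def markovOp (P : Matrix ι ι ℝ) : C(SFT A, ℝ) →ₗ[ℝ] C(SFT A, ℝ) where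
  toFun φ := ∑ i, cyl₁ (P i) * φ.comp ⟨cons i, continuous_cons i⟩
  map_add' φ ψ := by simp only [ContinuousMap.add_comp, mul_add, Finset.sum_add_distrib]
  map_smul' c φ := by
    simp only [ContinuousMap.smul_comp, mul_smul_comm, Finset.smul_sum, RingHom.id_apply]

theorem markovOp_apply (φ : C(SFT A, ℝ)) (x : SFT A) :
    markovOp P φ x = ∑ i, P i (x 0) * φ (cons i x) := by
  simp [markovOp, cyl₁_apply]

theorem IsMarkov.markovOp_nonneg (hP : IsMarkov A P) {φ : C(SFT A, ℝ)} (hφ : 0 ≤ φ) :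
    0 ≤ markovOp P φ := fun x => by
  change (0 : ℝ) ≤ markovOp P φ x
  rw [markovOp_apply]
  exact Finset.sum_nonneg fun i _ => mul_nonneg (hP.nonneg i _) (hφ _)

theorem IsMarkov.markovOp_one (hP : IsMarkov A P) : markovOp P (1 : C(SFT A, ℝ)) = 1 := by
  ext x
  simp [markovOp_apply, hP.sum_col]

theorem IsMarkov.markovOp_cyl₂ (hP : IsMarkov A P) (ψ : ι → ι → ℝ) :
    markovOp P (cyl₂ ψ : C(SFT A, ℝ)) = cyl₁ fun j => ∑ i, P i j * ψ i j := by
  ext x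
  rw [markovOp_apply, cyl₁_apply]
  refine Finset.sum_congr rfl fun i _ => hP.mul_congr fun hA => ?_
  rw [cyl₂_apply, cons_zero hA, cons_succ hA 0]

theorem IsMarkov.apply_cons_eq (hP : IsMarkov A P) {φ : C(SFT A, ℝ)} (hφ : markovOp P φ = φ)
    {x : SFT A} (hmax : ∀ y, φ y ≤ φ x) {i : ι} (hi : A i (x 0) = 1) : φ (cons i x) = φ x := by
  have hsum : ∑ j, P j (x 0) * (φ x - φ (cons j x)) = 0 := by
    simp only [mul_sub, Finset.sum_sub_distrib]
    rw [← Finset.sum_mul, hP.sum_col, one_mul, ← markovOp_apply, hφ, sub_self]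
  have hzero := (Finset.sum_eq_zero_iff_of_nonneg fun j _ =>
    mul_nonneg (hP.nonneg j (x 0)) (sub_nonneg.2 (hmax _))).1 hsum i (Finset.mem_univ i)
  have hsub := (mul_eq_zero.1 hzero).resolve_left ((hP.pos_iff _ _).2 hi).ne'
  exact (sub_eq_zero.1 hsub).symm

theorem IsMarkov.exists_eq_smul_one (hP : IsMarkov A P) [Nonempty (SFT A)] {φ : C(SFT A, ℝ)}
    (hφ : markovOp P φ = φ) : ∃ c : ℝ, φ = c • 1 := by
  obtain ⟨x₀, -, hx₀⟩ :=
    isCompact_univ.exists_isMaxOn Set.univ_nonempty φ.continuous.continuousOn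
  have hmax (x : SFT A) (hx : φ x = φ x₀) (y : SFT A) : φ y ≤ φ x := by
    rw [hx]
    exact hx₀ (Set.mem_univ y)
  have hdense : Dense {x | φ x = φ x₀} := hP.dense_of_cons_mem ⟨x₀, rfl⟩
    fun x hx i hi => (hP.apply_cons_eq hφ (hmax x hx) hi).trans hx
  have hall := (isClosed_eq φ.continuous continuous_const).closure_eq ▸ hdense.closure_eq
  refine ⟨φ x₀, ContinuousMap.ext fun x => ?_⟩
  have hx : x ∈ {x | φ x = φ x₀} := hall ▸ Set.mem_univ x
  simpa using hx

/-- `m` is a probability measure that is fixed by the dual of the Markov operator. -/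
structure IsInvariant (P : Matrix ι ι ℝ) (m : Measure (SFT A)) : Prop where
  prob : IsProbabilityMeasure m
  integral_markovOp : ∀ φ : C(SFT A, ℝ), ∫ x, markovOp P φ x ∂m = ∫ x, φ x ∂m

theorem IsMarkov.exists_isInvariant (hP : IsMarkov A P) [Nonempty (SFT A)] :
    ∃ m : Measure (SFT A), IsInvariant P m :=
  let ⟨m, hprob, hm⟩ :=
    exists_invariant_probabilityMeasure (fun _ hφ => hP.markovOp_nonneg hφ) hP.markovOp_one
  ⟨m, hprob, hm⟩

theorem IsMarkov.eigenvalue_eq_one (hP : IsMarkov A P) [Nonempty (SFT A)] {φ : C(SFT A, ℝ)}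
    {β : ℝ} (hpos : ∀ x, 0 < φ x) (hφ : markovOp P φ = β • φ) : β = 1 := by
  obtain ⟨m, hm⟩ := hP.exists_isInvariant
  have := hm.prob
  have hint : β * ∫ x, φ x ∂m = ∫ x, φ x ∂m := by
    have hφm := hm.integral_markovOp φ
    rw [hφ] at hφm
    exact (integral_const_mul β _).symm.trans hφm
  exact (mul_eq_right₀ (integral_pos_of_continuousMap hpos).ne').1 hint

section Integrals

variable {m m' : Measure (SFT A)}

theorem IsInvariant.integral_cyl₂ (hm : IsInvariant P m) (hP : IsMarkov A P) (ψ : ι → ι → ℝ) :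
    ∫ x, cyl₂ ψ x ∂m = ∫ x, cyl₁ (fun j => ∑ i, P i j * ψ i j) x ∂m := by
  rw [← hm.integral_markovOp, hP.markovOp_cyl₂]

theorem integral_cyl₁_eq_sum [DecidableEq ι] (m : Measure (SFT A)) [IsFiniteMeasure m]
    (ψ : ι → ℝ) :
    ∫ x, cyl₁ ψ x ∂m = ∑ i, ψ i * ∫ x, cyl₁ (Pi.single i 1) x ∂m := by
  have hψ (x : SFT A) : cyl₁ ψ x = ∑ i, ψ i * cyl₁ (Pi.single i 1) x := by
    simp [cyl₁_apply, Pi.single_apply]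
  simp only [hψ, ← integral_const_mul]
  exact integral_finsetSum _ fun i _ => (integrable_continuousMap m _).const_mul _

theorem IsInvariant.integral_cyl₁ [Nonempty ι] (hm : IsInvariant P m) (hP : IsMarkov A P)
    {p : ι → ℝ} (hp : P *ᵥ p = p) (hps : ∑ i, p i = 1) (ψ : ι → ℝ) :
    ∫ x, cyl₁ ψ x ∂m = ∑ i, ψ i * p i := by
  classical
  have := hm.prob
  let q (i : ι) : ℝ := ∫ x, cyl₁ (Pi.single i 1) x ∂m
  have hq : P *ᵥ q = q := by
    funext i
    have hcol : (fun j => ∑ k, P k j * Pi.single (M := fun _ => ℝ) i 1 k) = P i := by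
      funext j
      simp [Pi.single_apply]
    refine (integral_cyl₁_eq_sum m (P i)).symm.trans ?_
    rw [← hcol]
    exact (hm.integral_cyl₂ hP fun k _ => Pi.single (M := fun _ => ℝ) i 1 k).symm
  have hqs : ∑ i, q i = 1 := by
    simpa [cyl₁_apply, q] using (integral_cyl₁_eq_sum m fun _ => 1).symm
  rw [integral_cyl₁_eq_sum,
    (existsUnique_mulVec_eq hP.isIrreducible hP.sum_col).unique ⟨hp, hps⟩ ⟨hq, hqs⟩]

theorem IsMarkov.isInvariant_unique [Nonempty ι] (hP : IsMarkov A P) (hm : IsInvariant P m)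
    (hm' : IsInvariant P m') : m = m' := by
  have := hm.prob
  have := hm'.prob
  obtain ⟨p, ⟨hp, hps⟩, -⟩ := existsUnique_mulVec_eq hP.isIrreducible hP.sum_col
  refine ext_of_integral_cylinder_eq fun n => ?_
  induction n with
  | zero =>
    intro φ hφ
    choose z hz using hP.exists_zero_eq
    have hcyl : φ = cyl₁ fun i => φ (z i) := by
      ext x
      exact hφ _ _ fun k hk => by rw [Nat.le_zero.1 hk, hz]
    rw [hcyl, hm.integral_cyl₁ hP hp hps, hm'.integral_cyl₁ hP hp hps]
  | succ n ih =>
    intro φ hφ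
    rw [← hm.integral_markovOp, ← hm'.integral_markovOp]
    refine ih _ fun x y hxy => ?_
    rw [markovOp_apply, markovOp_apply, hxy 0 n.zero_le]
    refine Finset.sum_congr rfl fun i _ => hP.mul_congr fun hA => hφ _ _ fun k hk => ?_
    have hA' : A i (x 0) = 1 := by rwa [hxy 0 n.zero_le]
    cases k with
    | zero => rw [cons_zero hA, cons_zero hA']
    | succ k => rw [cons_succ hA, cons_succ hA', hxy k (Nat.le_of_succ_le_succ hk)]

end Integrals

/-- The potential `log P (x₀, x₁)`. -/
def markovPotential (P : Matrix ι ι ℝ) (x : SFT A) : ℝ := Real.log (P (x 0) (x 1))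

variable {f : SFT A → ℝ} {h : C(SFT A, ℝ)}

theorem IsMarkov.transfer_apply (hP : IsMarkov A P)
    (hf : ∀ x, f x - markovPotential P x = h (shift x) - h x) (w : C(SFT A, ℝ)) (x : SFT A) :
    transfer f w x = Real.exp (h x) * markovOp P (expMap (-h) * w) x := by
  classical
  rw [transfer_eq_sum, markovOp_apply, Finset.mul_sum, Finset.sum_filter]
  refine Finset.sum_congr rfl fun i _ => ?_
  split_ifs with hA
  · have hfi := hf (cons i x)
    rw [shift_cons hA, markovPotential, cons_zero hA, cons_succ hA 0] at hfi
    have hexp : Real.exp (f (cons i x)) =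
        P i (x 0) * Real.exp (h x) * Real.exp (-h (cons i x)) := by
      rw [← Real.exp_log ((hP.pos_iff i (x 0)).2 hA), ← Real.exp_add, ← Real.exp_add]
      congr 1
      linarith
    rw [hexp, ContinuousMap.mul_apply, expMap_apply, ContinuousMap.neg_apply]
    ring
  · have hzero : P i (x 0) = 0 :=
      ((hP.nonneg i _).eq_or_lt.resolve_right fun h => hA ((hP.pos_iff i _).1 h)).symm
    rw [hzero, zero_mul, mul_zero]

theorem IsMarkov.isNormalized_markovPotential (hP : IsMarkov A P) :
    IsNormalized (markovPotential P : SFT A → ℝ) := fun x => by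
  refine (hP.transfer_apply (h := 0) (fun _ => by simp) 1 x).trans ?_
  have hone : expMap (-0 : C(SFT A, ℝ)) * 1 = 1 := by
    ext
    simp [expMap_apply]
  rw [hone, hP.markovOp_one]
  simp

theorem IsMarkov.eq_markovPotential (hP : IsMarkov A P) [Nonempty (SFT A)] (hf : IsNormalized f)
    (hfP : ∀ x, f x - markovPotential P x = h (shift x) - h x) : f = markovPotential P := by
  have hharm : markovOp P (expMap (-h)) = expMap (-h) := by
    ext x
    have hx : Real.exp (h x) * markovOp P (expMap (-h) * 1) x = 1 :=
      (hP.transfer_apply hfP 1 x).symm.trans (hf x)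
    rw [mul_one] at hx
    rw [expMap_apply, ContinuousMap.neg_apply, Real.exp_neg]
    exact eq_inv_of_mul_eq_one_right hx
  obtain ⟨c, hc⟩ := hP.exists_eq_smul_one hharm
  have hconst (x : SFT A) : Real.exp (-h x) = c := by
    simpa [expMap_apply] using congrArg (fun φ : C(SFT A, ℝ) => φ x) hc
  funext x
  have := Real.exp_injective ((hconst (shift x)).trans (hconst x).symm)
  linarith [hfP x]

theorem IsMarkov.isInvariant_of_isEquilibriumState (hP : IsMarkov A P) [Nonempty (SFT A)]
    (hf : ∀ x, f x - markovPotential P x = h (shift x) - h x) {m : Measure (SFT A)}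
    (hm : IsEquilibriumState f m) : IsInvariant P m := by
  obtain ⟨β, v, μ, -, hv, hvβ, hμ, hμβ, rfl⟩ := hm
  have hmul (w : C(SFT A, ℝ)) : expMap (-h) * (expMap h * w) = w := by
    rw [← mul_assoc, expMap_neg_mul_self, one_mul]
  have heig : markovOp P (expMap (-h) * v) = β • (expMap (-h) * v) := by
    ext x
    have hx := (hP.transfer_apply hf v x).symm.trans (hvβ x)
    simp only [ContinuousMap.smul_apply, ContinuousMap.mul_apply, smul_eq_mul, expMap_apply,
      ContinuousMap.neg_apply, Real.exp_neg]
    field_simp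
    linarith
  obtain rfl := hP.eigenvalue_eq_one (fun x => mul_pos (Real.exp_pos _) (hv x)) heig
  obtain ⟨c, hc⟩ := hP.exists_eq_smul_one (heig.trans (one_smul _ _))
  have hvc (x : SFT A) : v x = c * Real.exp (h x) := by
    have hx : Real.exp (-h x) * v x = c := by
      simpa [expMap_apply] using congrArg (fun φ : C(SFT A, ℝ) => φ x) hc
    rw [← hx, Real.exp_neg]
    field_simp
  refine ⟨isProbabilityMeasure_normalizedDensity hv, fun φ => ?_⟩
  change ∫ x, _ ∂(normalizedDensity v μ) = ∫ x, _ ∂(normalizedDensity v μ)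
  have hφ := hμβ (expMap h * φ)
  simp only [hP.transfer_apply hf, hmul, one_mul] at hφ
  simp only [integral_normalizedDensity hv, hvc, mul_assoc, integral_const_mul, hφ]
  rfl

theorem IsMarkov.isEquilibriumState_of_isInvariant (hP : IsMarkov A P)
    (hf : ∀ x, f x - markovPotential P x = h (shift x) - h x) {m : Measure (SFT A)}
    (hm : IsInvariant P m) : IsEquilibriumState f m := by
  have := hm.prob
  have hpos (h : C(SFT A, ℝ)) (x : SFT A) : 0 < expMap h x := Real.exp_pos _
  refine ⟨1, expMap h, normalizedDensity (expMap (-h)) m, one_pos, hpos h, fun x => ?_,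
    isProbabilityMeasure_normalizedDensity (hpos (-h)), fun φ => ?_,
    (normalizedDensity_normalizedDensity (hpos h) (hpos (-h)) (expMap_neg_mul_self h)).symm⟩
  · rw [hP.transfer_apply hf, expMap_neg_mul_self, hP.markovOp_one, one_mul]
    exact mul_one _
  · have hcancel (x : SFT A) : expMap (-h) x * transfer f φ x =
        markovOp P (expMap (-h) * φ) x := by
      rw [hP.transfer_apply hf, ← mul_assoc, ← expMap_apply, ← ContinuousMap.mul_apply,
        expMap_neg_mul_self, ContinuousMap.one_apply, one_mul]
    simp only [integral_normalizedDensity (hpos (-h)), hcancel, hm.integral_markovOp, one_mul]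
    rfl

theorem IsMarkov.isEquilibriumState_iff (hP : IsMarkov A P) [Nonempty (SFT A)]
    (hf : ∀ x, f x - markovPotential P x = h (shift x) - h x) {m : Measure (SFT A)} :
    IsEquilibriumState f m ↔ IsInvariant P m :=
  ⟨hP.isInvariant_of_isEquilibriumState hf, hP.isEquilibriumState_of_isInvariant hf⟩

end Markov

end SFT

theorem abs_add_sq_sub_sq_le {s c C η : ℝ} (hη : 0 < η) (hc : |c| ≤ C) :
    |(s + c) ^ 2 - s ^ 2| ≤ η * s ^ 2 + (C ^ 2 / η + C ^ 2) := by
  have hcC : c ^ 2 ≤ C ^ 2 := sq_le_sq.2 (hc.trans (le_abs_self C))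
  have hcη : c ^ 2 / η ≤ C ^ 2 / η := div_le_div_of_nonneg_right hcC hη.le
  have hamgm : |2 * s * c| ≤ η * s ^ 2 + c ^ 2 / η := by
    have hsub : η * s ^ 2 - 2 * s * c + c ^ 2 / η = (η * s - c) ^ 2 / η := by field_simp; ring
    have hadd : η * s ^ 2 + 2 * s * c + c ^ 2 / η = (η * s + c) ^ 2 / η := by field_simp; ring
    have := hsub ▸ div_nonneg (sq_nonneg (η * s - c)) hη.le
    have := hadd ▸ div_nonneg (sq_nonneg (η * s + c)) hη.le
    exact abs_le.2 ⟨by linarith, by linarith⟩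
  calc |(s + c) ^ 2 - s ^ 2| = |2 * s * c + c ^ 2| := by ring_nf
    _ ≤ |2 * s * c| + |c ^ 2| := abs_add_le _ _
    _ ≤ η * s ^ 2 + (C ^ 2 / η + C ^ 2) := by rw [abs_of_nonneg (sq_nonneg c)]; linarith

section Perturbation

variable {X : Type*} [TopologicalSpace X] [CompactSpace X] [MeasurableSpace X] [BorelSpace X]
  {m : Measure X} [IsProbabilityMeasure m]

theorem abs_integral_add_sq_sub_le (s c : C(X, ℝ)) {C η : ℝ} (hη : 0 < η) (hc : ∀ x, |c x| ≤ C) :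
    |∫ x, (s x + c x) ^ 2 ∂m - ∫ x, s x ^ 2 ∂m| ≤
      η * ∫ x, s x ^ 2 ∂m + (C ^ 2 / η + C ^ 2) := by
  have hs : Integrable (fun x => s x ^ 2) m := integrable_continuousMap m (s ^ 2)
  have hsc : Integrable (fun x => (s x + c x) ^ 2) m := integrable_continuousMap m ((s + c) ^ 2)
  rw [← integral_sub hsc hs, ← Real.norm_eq_abs]
  calc ‖∫ x, ((s x + c x) ^ 2 - s x ^ 2) ∂m‖
      ≤ ∫ x, (η * s x ^ 2 + (C ^ 2 / η + C ^ 2)) ∂m :=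
        norm_integral_le_of_norm_le ((hs.const_mul η).fun_add (integrable_const _))
          (ae_of_all _ fun x => abs_add_sq_sub_sq_le hη (hc x))
    _ = η * ∫ x, s x ^ 2 ∂m + (C ^ 2 / η + C ^ 2) := by
        rw [integral_add (hs.const_mul η) (integrable_const _), integral_const_mul]
        simp

theorem tendsto_integral_add_sq {s c : ℕ → C(X, ℝ)} {C W : ℝ}
    (hs : ∀ n, ∫ x, s n x ^ 2 ∂m = n * W) (hc : ∀ n x, |c n x| ≤ C) :
    Tendsto (fun n : ℕ => 1 / (n : ℝ) * ∫ x, (s n x + c n x) ^ 2 ∂m) atTop (𝓝 W) := by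
  have hlim : Tendsto (fun n : ℕ => (W + C ^ 2) * (1 / √n) + C ^ 2 * (1 / (n : ℝ)))
      atTop (𝓝 0) := by
    have hsqrt : Tendsto (fun n : ℕ => 1 / √n) atTop (𝓝 0) :=
      tendsto_const_nhds.div_atTop (Real.tendsto_sqrt_atTop.comp tendsto_natCast_atTop_atTop)
    simpa using (hsqrt.const_mul (W + C ^ 2)).add
      ((tendsto_one_div_atTop_nhds_zero_nat (𝕜 := ℝ)).const_mul (C ^ 2))
  refine tendsto_iff_norm_sub_tendsto_zero.2
    (squeeze_zero' (Eventually.of_forall fun _ => norm_nonneg _) ?_ hlim)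
  filter_upwards [eventually_gt_atTop 0] with n hn
  have hn : (0 : ℝ) < n := Nat.cast_pos.2 hn
  obtain ⟨q, hq, hqn⟩ : ∃ q : ℝ, 0 < q ∧ √n = q := ⟨_, Real.sqrt_pos.2 hn, rfl⟩
  have hnq : (n : ℝ) = q ^ 2 := by rw [← hqn, Real.sq_sqrt hn.le]
  have hfactor (I : ℝ) : 1 / (n : ℝ) * I - W = 1 / n * (I - n * W) := by field_simp
  calc ‖1 / (n : ℝ) * ∫ x, (s n x + c n x) ^ 2 ∂m - W‖
      = 1 / n * |∫ x, (s n x + c n x) ^ 2 ∂m - ∫ x, s n x ^ 2 ∂m| := by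
        rw [hfactor, Real.norm_eq_abs, abs_mul, abs_of_pos (one_div_pos.2 hn), hs]
    _ ≤ 1 / n * (1 / q * ∫ x, s n x ^ 2 ∂m + (C ^ 2 / (1 / q) + C ^ 2)) :=
        mul_le_mul_of_nonneg_left
          (abs_integral_add_sq_sub_le _ _ (one_div_pos.2 hq) (hc n)) (one_div_pos.2 hn).le
    _ = (W + C ^ 2) * (1 / √n) + C ^ 2 * (1 / (n : ℝ)) := by
        rw [hs, hqn, hnq]
        field_simp
        ring

end Perturbation

theorem birkhoffSum_add_coboundary {X : Type*} (T : X → X) (Ψ U : X → ℝ) (n : ℕ) (x : X) :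
    birkhoffSum T (fun x => Ψ x + (U (T x) - U x)) n x =
      birkhoffSum T Ψ n x + (U (T^[n] x) - U x) := by
  rw [birkhoffSum, Finset.sum_add_distrib]
  simp only [← Function.iterate_succ_apply' T]
  exact congrArg _ (Finset.sum_range_sub (fun k => U (T^[k] x)) n)

namespace SFT

section Variance

variable {ι : Type*} [TopologicalSpace ι] {A : Matrix ι ι ℝ}

theorem continuous_birkhoffSum (φ : C(SFT A, ℝ)) (n : ℕ) : Continuous (birkhoffSum shift φ n) :=
  continuous_finsetSum _ fun k _ => φ.continuous.comp (continuous_shift.iterate k)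

variable [DiscreteTopology ι] {m : Measure (SFT A)}

theorem integrable_comp_shift [Finite ι] [IsFiniteMeasure m] (φ : C(SFT A, ℝ)) :
    Integrable (fun x => φ (shift x)) m :=
  integrable_continuousMap m (φ.comp ⟨shift, continuous_shift⟩)

variable [Fintype ι] {P : Matrix ι ι ℝ}

theorem IsInvariant.integral_comp_shift_mul (hm : IsInvariant P m) (hP : IsMarkov A P)
    (φ ψ : C(SFT A, ℝ)) : ∫ x, φ (shift x) * ψ x ∂m = ∫ x, φ x * markovOp P ψ x ∂m := by
  refine (hm.integral_markovOp (φ.comp ⟨shift, continuous_shift⟩ * ψ)).symm.trans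
    (integral_congr_ae (ae_of_all _ fun x => ?_))
  simp only [markovOp_apply, Finset.mul_sum, mul_left_comm (φ x)]
  refine Finset.sum_congr rfl fun i _ => hP.mul_congr fun hA => ?_
  change φ (shift (cons i x)) * ψ (cons i x) = _
  rw [shift_cons hA]

theorem IsInvariant.integral_comp_shift (hm : IsInvariant P m) (hP : IsMarkov A P)
    (φ : C(SFT A, ℝ)) : ∫ x, φ (shift x) ∂m = ∫ x, φ x ∂m := by
  simpa [hP.markovOp_one] using hm.integral_comp_shift_mul hP φ 1

theorem IsInvariant.integral_add_coboundary (hm : IsInvariant P m) (hP : IsMarkov A P)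
    (ψ u : C(SFT A, ℝ)) : ∫ x, (ψ x + (u (shift x) - u x)) ∂m = ∫ x, ψ x ∂m := by
  have := hm.prob
  have hshift : Integrable (fun x => u (shift x)) m := integrable_comp_shift u
  have hu := integrable_continuousMap m u
  have hcob : Integrable (fun x => u (shift x) - u x) m := hshift.sub hu
  rw [integral_add (integrable_continuousMap m ψ) hcob, integral_sub hshift hu,
    hm.integral_comp_shift hP, sub_self, add_zero]

-- `L (S ∘ σ · ψ) = S · L ψ = 0` makes `ψ` orthogonal to `S ∘ σ`, so that the squares add up.
theorem IsInvariant.integral_birkhoffSum_sq (hm : IsInvariant P m) (hP : IsMarkov A P)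
    {ψ : C(SFT A, ℝ)} (hψ : markovOp P ψ = 0) (n : ℕ) :
    ∫ x, birkhoffSum shift ψ n x ^ 2 ∂m = n * ∫ x, ψ x ^ 2 ∂m := by
  have := hm.prob
  induction n with
  | zero => simp [birkhoffSum_zero]
  | succ n ih =>
    let S : C(SFT A, ℝ) := ⟨birkhoffSum shift ψ n, continuous_birkhoffSum ψ n⟩
    have hexpand (x : SFT A) : birkhoffSum shift ψ (n + 1) x ^ 2 =
        ψ x ^ 2 + 2 * (S (shift x) * ψ x) + (S ^ 2) (shift x) := by
      rw [birkhoffSum_succ', ContinuousMap.pow_apply]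
      change (ψ x + S (shift x)) ^ 2 = _
      ring
    have hsq : Integrable (fun x => ψ x ^ 2) m := integrable_continuousMap m (ψ ^ 2)
    have hcross : Integrable (fun x => 2 * (S (shift x) * ψ x)) m :=
      (integrable_continuousMap m (S.comp ⟨shift, continuous_shift⟩ * ψ)).const_mul 2
    have hrest : Integrable (fun x => (S ^ 2) (shift x)) m := integrable_comp_shift (S ^ 2)
    have horth : ∫ x, S (shift x) * ψ x ∂m = 0 := by
      simp [hm.integral_comp_shift_mul hP, hψ]
    have hS : ∫ x, (S ^ 2) x ∂m = n * ∫ x, ψ x ^ 2 ∂m := ih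
    simp only [hexpand]
    rw [integral_add (hsq.fun_add hcross) hrest, integral_add hsq hcross, integral_const_mul, horth,
      hm.integral_comp_shift hP, hS]
    push_cast
    ring

theorem IsInvariant.hasVariance_add_coboundary (hm : IsInvariant P m) (hP : IsMarkov A P)
    {ψ : C(SFT A, ℝ)} (hψ : markovOp P ψ = 0) (u : C(SFT A, ℝ)) :
    HasVariance (fun x => ψ x + (u (shift x) - u x)) m (∫ x, ψ x ^ 2 ∂m) := by
  have := hm.prob
  let s (n : ℕ) : C(SFT A, ℝ) := ⟨birkhoffSum shift ψ n, continuous_birkhoffSum ψ n⟩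
  let c (n : ℕ) : C(SFT A, ℝ) := u.comp ⟨shift^[n], continuous_shift.iterate n⟩ - u
  have hc (n : ℕ) (x : SFT A) : |c n x| ≤ 2 * ‖u‖ :=
    calc |u (shift^[n] x) - u x| ≤ |u (shift^[n] x)| + |u x| := abs_sub _ _
      _ ≤ 2 * ‖u‖ := by
        rw [two_mul]
        exact add_le_add (u.norm_coe_le_norm _) (u.norm_coe_le_norm _)
  have hmean : ∫ x, (ψ x + (u (shift x) - u x)) ∂m = 0 := by
    rw [hm.integral_add_coboundary hP, ← hm.integral_markovOp, hψ]
    simp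
  unfold HasVariance
  simp only [hmean, mul_zero, sub_zero, birkhoffSum_add_coboundary]
  exact tendsto_integral_add_sq (s := s) (c := c) (hm.integral_birkhoffSum_sq hP hψ) hc

theorem IsInvariant.hasVariance_cyl₁ (hm : IsInvariant P m) (hP : IsMarkov A P) {a b : ι → ℝ}
    (hab : ∀ j, ∑ i, P i j * (a i + b i - b j) = 0) :
    HasVariance (cyl₁ a) m (∫ x, cyl₂ (fun i j => (a i + b i - b j) ^ 2) x ∂m) := by
  have hψ : markovOp P (cyl₂ fun i j => a i + b i - b j : C(SFT A, ℝ)) = 0 := by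
    rw [hP.markovOp_cyl₂]
    ext x
    exact hab (x 0)
  have hcob : (cyl₁ a : SFT A → ℝ) = fun x => (cyl₂ fun i j => a i + b i - b j : C(SFT A, ℝ)) x +
      ((cyl₁ b : C(SFT A, ℝ)) (shift x) - (cyl₁ b : C(SFT A, ℝ)) x) := by
    funext x
    change a (x 0) = a (x 0) + b (x 0) - b (x 1) + (b (x 1) - b (x 0))
    ring
  rw [hcob]
  exact hm.hasVariance_add_coboundary hP hψ (cyl₁ b)

theorem IsInvariant.integral_cyl₂_eq_integral_cyl₁_neg (hm : IsInvariant P m) (hP : IsMarkov A P)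
    {q : ι → ι → ℝ} {a b : ι → ℝ} (hq : ∀ j, ∑ i, P i j * (q i j + (a i + b i - b j)) = 0) :
    ∫ x, cyl₂ q x ∂m = ∫ x, cyl₁ (-a) x ∂m := by
  have := hm.prob
  have hzero : ∫ x, cyl₂ (fun i j => q i j + (a i + b i - b j)) x ∂m = 0 := by
    rw [hm.integral_cyl₂ hP]
    simp only [hq, cyl₁_apply, integral_zero]
  have hsplit (x : SFT A) : (cyl₁ (-a) : C(SFT A, ℝ)) x + (cyl₁ b (shift x) - cyl₁ b x) =
      cyl₂ q x - cyl₂ (fun i j => q i j + (a i + b i - b j)) x := by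
    change -a (x 0) + (b (x 1) - b (x 0)) = q (x 0) (x 1) - (q (x 0) (x 1) + _)
    ring
  rw [← hm.integral_add_coboundary hP (cyl₁ (-a)) (cyl₁ b)]
  simp only [hsplit]
  rw [integral_sub (integrable_continuousMap m _) (integrable_continuousMap m _), hzero, sub_zero]

theorem IsInvariant.integral_cyl₂_eq_sum [Nonempty ι] (hm : IsInvariant P m) (hP : IsMarkov A P)
    {p : ι → ℝ} (hp : P *ᵥ p = p) (hps : ∑ i, p i = 1) (ψ : ι → ι → ℝ) :
    ∫ x, cyl₂ ψ x ∂m = ∑ i, ∑ j, ψ i j * P i j * p j := by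
  rw [hm.integral_cyl₂ hP, hm.integral_cyl₁ hP hp hps, Finset.sum_comm]
  simp only [Finset.sum_mul, mul_comm (P _ _)]

end Variance

end SFT

section Bordered

variable {ι : Type*} [Fintype ι] {B : Matrix ι ι ℝ}

/-- The matrix `1 - B + e 1ᵀ`, where `e` is the basis vector of `i₀`. Its left kernel vanishes if
`B` has a simple eigenvalue `1`, and the left eigenvector `v` with `v i₀ = 1` solves
`v ᵥ* bordered B i₀ = 1`, so that it depends smoothly on `B`. -/
def bordered [DecidableEq ι] (B : Matrix ι ι ℝ) (i₀ : ι) : Matrix ι ι ℝ :=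
  1 - B + vecMulVec (Pi.single i₀ 1) 1

theorem vecMul_bordered [DecidableEq ι] (B : Matrix ι ι ℝ) (i₀ : ι) (w : ι → ℝ) :
    w ᵥ* bordered B i₀ = w - w ᵥ* B + w i₀ • 1 := by
  rw [bordered, vecMul_add, vecMul_sub, vecMul_one, vecMul_vecMulVec, dotProduct_single_one]

theorem det_bordered_ne_zero [DecidableEq ι] [Nonempty ι] (hirr : B.IsIrreducible)
    {v : ι → ℝ} (hv : ∀ i, 0 < v i) (hvB : v ᵥ* B = v) (i₀ : ι) : (bordered B i₀).det ≠ 0 := by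
  intro hdet
  obtain ⟨w, hw_ne, hw⟩ := exists_vecMul_eq_zero_iff.2 hdet
  rw [vecMul_bordered] at hw
  obtain ⟨q, hq, hqB⟩ := exists_pos_mulVec_eq hirr hv hvB
  have hwi : w i₀ = 0 := by
    have hwq : w i₀ * ∑ i, q i = 0 := by
      simpa [add_dotProduct, sub_dotProduct, ← dotProduct_mulVec, hqB,
        one_dotProduct] using congrArg (· ⬝ᵥ q) hw
    exact (mul_eq_zero.1 hwq).resolve_right
      (Finset.sum_pos (fun i _ => hq i) Finset.univ_nonempty).ne'
  have hwB : w ᵥ* B = w := by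
    rw [hwi, zero_smul, add_zero] at hw
    exact (sub_eq_zero.1 hw).symm
  obtain ⟨c, rfl⟩ := eq_smul_of_vecMul_eq_smul hirr hv (by rwa [one_smul]) (by rwa [one_smul])
  have hc : c = 0 := (mul_eq_zero.1 hwi).resolve_right (hv i₀).ne'
  exact hw_ne (by rw [hc, zero_smul])

theorem eq_one_vecMul_bordered_inv [DecidableEq ι] {v : ι → ℝ} (hvB : v ᵥ* B = v) {i₀ : ι}
    (hv₀ : v i₀ = 1) (hdet : (bordered B i₀).det ≠ 0) : v = 1 ᵥ* (bordered B i₀)⁻¹ := by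
  have hv : v ᵥ* bordered B i₀ = 1 := by
    rw [vecMul_bordered, hvB, sub_self, zero_add, hv₀, one_smul]
  rw [← hv, vecMul_vecMul, mul_nonsing_inv _ (isUnit_iff_ne_zero.2 hdet), vecMul_one]

variable {F : Type*} [NormedAddCommGroup F] [NormedSpace ℝ F] {n : WithTop ℕ∞} {s : Set F}
  {M : F → Matrix ι ι ℝ}

theorem contDiffOn_det [DecidableEq ι] (hM : ∀ i j, ContDiffOn ℝ n (fun t => M t i j) s) :
    ContDiffOn ℝ n (fun t => (M t).det) s := by
  simp only [det_apply']
  exact ContDiffOn.sum fun σ _ => contDiffOn_const.mul (contDiffOn_prod fun i _ => hM _ _)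

theorem contDiffOn_inv_apply [DecidableEq ι]
    (hM : ∀ i j, ContDiffOn ℝ n (fun t => M t i j) s) (hdet : ∀ t ∈ s, (M t).det ≠ 0) (i j : ι) :
    ContDiffOn ℝ n (fun t => (M t)⁻¹ i j) s := by
  simp only [inv_def, Matrix.smul_apply, Ring.inverse_eq_inv', smul_eq_mul, adjugate_apply]
  refine ((contDiffOn_det hM).inv hdet).mul (contDiffOn_det fun a b => ?_)
  simp only [updateRow_apply]
  split_ifs
  · exact contDiffOn_const
  · exact hM a b

theorem exists_contDiffOn_vecMul_eq [Nonempty ι]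
    (hM : ∀ i j, ContDiffOn ℝ n (fun t => M t i j) s) (hirr : ∀ t ∈ s, (M t).IsIrreducible)
    (hex : ∀ t ∈ s, ∃ v : ι → ℝ, (∀ i, 0 < v i) ∧ v ᵥ* M t = v) :
    ∃ w : F → ι → ℝ, ContDiffOn ℝ n w s ∧ ∀ t ∈ s, (∀ i, 0 < w t i) ∧ w t ᵥ* M t = w t := by
  classical
  obtain ⟨i₀⟩ := id ‹Nonempty ι›
  have hdet (t : F) (ht : t ∈ s) : (bordered (M t) i₀).det ≠ 0 := by
    obtain ⟨v, hv, hvM⟩ := hex t ht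
    exact det_bordered_ne_zero (hirr t ht) hv hvM i₀
  refine ⟨fun t => 1 ᵥ* (bordered (M t) i₀)⁻¹, contDiffOn_pi.2 fun j => ?_, fun t ht => ?_⟩
  · simp only [vecMul, dotProduct, Pi.one_apply, one_mul]
    refine ContDiffOn.sum fun i _ => contDiffOn_inv_apply (fun a b => ?_) hdet i j
    exact (contDiffOn_const.sub (hM a b)).add contDiffOn_const
  · obtain ⟨v, hv, hvM⟩ := hex t ht
    have hnorm : (v i₀)⁻¹ • v = 1 ᵥ* (bordered (M t) i₀)⁻¹ :=
      eq_one_vecMul_bordered_inv (by rw [smul_vecMul, hvM]) (inv_mul_cancel₀ (hv i₀).ne')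
        (hdet t ht)
    simp only [← hnorm, smul_vecMul, hvM]
    exact ⟨fun i => mul_pos (inv_pos.2 (hv i₀)) (hv i), trivial⟩

end Bordered

section Deriv

theorem differentiableAt_deriv {F : Type*} [NormedAddCommGroup F] [NormedSpace ℝ F]
    {n : WithTop ℕ∞} (hn : 2 ≤ n) {s : Set ℝ} (hs : IsOpen s) {f : ℝ → F} (hf : ContDiffOn ℝ n f s)
    {t : ℝ} (ht : t ∈ s) : DifferentiableAt ℝ (deriv f) t :=
  ((hf.of_le hn).deriv_of_isOpen (m := 1) hs one_add_one_eq_two.le).contDiffAt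
    (hs.mem_nhds ht) |>.differentiableAt one_ne_zero

variable {ι : Type*} [Fintype ι] {a : ι → ℝ} {f : ι → ℝ → ℝ} {c : ℝ}

theorem sum_mul_exp_mul_deriv_eq_zero {t : ℝ} (hf : ∀ i, DifferentiableAt ℝ (f i) t)
    (hsum : ∀ᶠ τ in 𝓝 t, ∑ i, a i * Real.exp (f i τ) = c) :
    ∑ i, a i * Real.exp (f i t) * deriv (f i) t = 0 := by
  have hderiv : HasDerivAt (fun τ => ∑ i, a i * Real.exp (f i τ))
      (∑ i, a i * (Real.exp (f i t) * deriv (f i) t)) t :=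
    HasDerivAt.fun_sum fun i _ => (hf i).hasDerivAt.exp.const_mul (a i)
  simp only [mul_assoc]
  exact hderiv.unique ((hasDerivAt_const t c).congr_of_eventuallyEq hsum)

theorem sum_mul_exp_mul_deriv_sq_add_eq_zero {n : WithTop ℕ∞} (hn : 2 ≤ n) {s : Set ℝ}
    (hs : IsOpen s) (hf : ∀ i, ContDiffOn ℝ n (f i) s)
    (hsum : ∀ t ∈ s, ∑ i, a i * Real.exp (f i t) = c) {t : ℝ} (ht : t ∈ s) :
    ∑ i, a i * Real.exp (f i t) * (deriv (f i) t ^ 2 + deriv (deriv (f i)) t) = 0 := by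
  have hdiff (i : ι) {τ : ℝ} (hτ : τ ∈ s) : DifferentiableAt ℝ (f i) τ :=
    ((hf i).differentiableOn (two_pos.trans_le hn).ne').differentiableAt (hs.mem_nhds hτ)
  have hfirst : ∀ᶠ τ in 𝓝 t, ∑ i, a i * Real.exp (f i τ) * deriv (f i) τ = 0 := by
    filter_upwards [hs.mem_nhds ht] with τ hτ
    exact sum_mul_exp_mul_deriv_eq_zero (fun i => hdiff i hτ)
      (eventually_of_mem (hs.mem_nhds hτ) hsum)
  have hderiv : HasDerivAt (fun τ => ∑ i, a i * Real.exp (f i τ) * deriv (f i) τ)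
      (∑ i, (a i * (Real.exp (f i t) * deriv (f i) t) * deriv (f i) t +
        a i * Real.exp (f i t) * deriv (deriv (f i)) t)) t :=
    HasDerivAt.fun_sum fun i _ => ((hdiff i ht).hasDerivAt.exp.const_mul (a i)).mul
      (differentiableAt_deriv hn hs (hf i) ht).hasDerivAt
  rw [← hderiv.unique ((hasDerivAt_const t 0).congr_of_eventuallyEq hfirst)]
  exact Finset.sum_congr rfl fun i _ => by ring

end Deriv

theorem SFT.IsMarkov.existsUnique_isInvariant {ι : Type*} [Fintype ι] [Nonempty ι]
    [TopologicalSpace ι] [DiscreteTopology ι] {A P : Matrix ι ι ℝ} (hP : SFT.IsMarkov A P) :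
    ∃! m : Measure (SFT A), SFT.IsInvariant P m :=
  have := hP.nonempty
  let ⟨m, hm⟩ := hP.exists_isInvariant
  ⟨m, hm, fun _ hm' => hP.isInvariant_unique hm' hm⟩

theorem exists_eq_exp_comp {α : Type*} {v : α → ℝ} (hv : ∀ i, 0 < v i) :
    ∃ u : α → ℝ, v = Real.exp ∘ u :=
  ⟨Real.log ∘ v, funext fun i => (Real.exp_log (hv i)).symm⟩

namespace UGraph

variable {V E : Type*} {G : UGraph V E}

section TransitionPotential

variable {l : E → ℝ} {u : DirEdge E → ℝ}

/-- The potential of the chain `G.transition l (Real.exp ∘ u)`: minus the weight plus the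
coboundary of `-u`. Writing the eigenvector as `exp ∘ u` makes it linear in `(l, u)`, so that it
commutes with differentiation along a path. -/
def transitionPotential (l : E → ℝ) (u : DirEdge E → ℝ) (i j : DirEdge E) : ℝ :=
  -l i.edge + u i - u j

theorem transition_exp_comp (i j : DirEdge E) :
    G.transition l (Real.exp ∘ u) i j = G.adj i j * Real.exp (transitionPotential l u i j) := by
  rw [transition, transitionPotential, Real.exp_sub, Real.exp_add, Function.comp_apply,
    Function.comp_apply]
  ring

theorem transition_eq_mul_weighted_div (v : DirEdge E → ℝ) (i j : DirEdge E) :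
    G.transition l v i j = v i * G.weighted l i j / v j := by
  rw [transition, weighted]
  ring

theorem markovPotential_transition :
    SFT.markovPotential (G.transition l (Real.exp ∘ u)) =
      (SFT.cyl₂ (transitionPotential l u) : C(SFT G.adj, ℝ)) := by
  funext x
  rw [SFT.markovPotential, transition_exp_comp, x.2 0, one_mul, Real.log_exp, SFT.cyl₂_apply]

theorem neg_onShift_sub_cyl₂_transitionPotential (x : SFT G.adj) :
    -G.onShift l x - SFT.cyl₂ (transitionPotential l u) x =
      (SFT.cyl₁ u : C(SFT G.adj, ℝ)) (SFT.shift x) - SFT.cyl₁ u x := by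
  change -l (x 0).edge - (-l (x 0).edge + u (x 0) - u (x 1)) = u (x 1) - u (x 0)
  ring

variable [Fintype E]

theorem sum_transition {v : DirEdge E → ℝ} (hvl : v ᵥ* G.weighted l = v) (hv : ∀ i, v i ≠ 0)
    (j : DirEdge E) : ∑ i, G.transition l v i j = 1 := by
  simp only [transition_eq_mul_weighted_div, ← Finset.sum_div]
  rw [div_eq_one_iff_eq (hv j)]
  exact congrFun hvl j

theorem isMarkov_transition
    (hadj : ∀ i j : DirEdge E, Relation.TransGen (fun a b => G.adj a b = 1) i j)
    (hu : (Real.exp ∘ u) ᵥ* G.weighted l = Real.exp ∘ u) :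
    SFT.IsMarkov G.adj (G.transition l (Real.exp ∘ u)) where
  nonneg i j := by
    rw [transition_exp_comp]
    exact mul_nonneg (adj_nonneg G i j) (Real.exp_pos _).le
  pos_iff i j := by
    rw [transition_exp_comp, mul_pos_iff_of_pos_right (Real.exp_pos _), adj_pos_iff]
  sum_col := sum_transition hu (fun _ => Real.exp_ne_zero _)
  transGen := hadj

variable [Nonempty (DirEdge E)]

theorem exists_exp_comp_vecMul_eq
    (hadj : ∀ i j : DirEdge E, Relation.TransGen (fun a b => G.adj a b = 1) i j)
    (hl : l ∈ G.entropyOne) :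
    ∃ u : DirEdge E → ℝ, (Real.exp ∘ u) ᵥ* G.weighted l = Real.exp ∘ u := by
  obtain ⟨r, v, hv, hvr⟩ := exists_pos_vecMul_eq_smul (weighted_isIrreducible hadj l)
  obtain rfl := eigenvalue_eq_one hadj hl hv hvr
  obtain ⟨u, rfl⟩ := exists_eq_exp_comp hv
  exact ⟨u, by rwa [one_smul] at hvr⟩

theorem transition_eq_of_vecMul_eq
    (hadj : ∀ i j : DirEdge E, Relation.TransGen (fun a b => G.adj a b = 1) i j)
    {v w : DirEdge E → ℝ} (hv : ∀ i, 0 < v i) (hvl : v ᵥ* G.weighted l = v)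
    (hw : ∀ i, 0 < w i) (hwl : w ᵥ* G.weighted l = w) :
    G.transition l w = G.transition l v := by
  obtain ⟨c, rfl⟩ := eq_smul_of_vecMul_eq_smul (weighted_isIrreducible hadj l) hv
    (hvl.trans (one_smul ℝ v).symm) (hwl.trans (one_smul ℝ w).symm)
  obtain ⟨e⟩ := id ‹Nonempty (DirEdge E)›
  have hc : c ≠ 0 := left_ne_zero_of_mul (hw e).ne'
  ext i j
  have := (hv j).ne'
  simp only [transition, Pi.smul_apply, smul_eq_mul]
  field_simp


theorem isNormalizedPotential_iff (hP : SFT.IsMarkov G.adj (G.transition l (Real.exp ∘ u)))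
    {g : SFT G.adj → ℝ} :
    G.IsNormalizedPotential l g ↔ g = SFT.cyl₂ (transitionPotential l u) := by
  have := hP.nonempty
  rw [← markovPotential_transition]
  constructor
  · rintro ⟨hg, h, hlg⟩
    refine hP.eq_markovPotential (h := SFT.cyl₁ u - h) hg fun x => ?_
    rw [markovPotential_transition, ContinuousMap.sub_apply, ContinuousMap.sub_apply]
    linarith [hlg x, neg_onShift_sub_cyl₂_transitionPotential (l := l) (u := u) x]
  · rintro rfl
    refine ⟨hP.isNormalized_markovPotential, SFT.cyl₁ u, fun x => ?_⟩
    rw [markovPotential_transition]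
    exact neg_onShift_sub_cyl₂_transitionPotential x

theorem isEquilibriumState_neg_onShift_iff
    (hP : SFT.IsMarkov G.adj (G.transition l (Real.exp ∘ u))) {m : Measure (SFT G.adj)} :
    SFT.IsEquilibriumState (fun x => -G.onShift l x) m ↔
      SFT.IsInvariant (G.transition l (Real.exp ∘ u)) m := by
  have := hP.nonempty
  refine hP.isEquilibriumState_iff (h := SFT.cyl₁ u) fun x => ?_
  rw [markovPotential_transition]
  exact neg_onShift_sub_cyl₂_transitionPotential x

theorem IsNormalizedPotential.isEquilibriumState_iff {g : SFT G.adj → ℝ}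
    (hg : G.IsNormalizedPotential l g)
    (hP : SFT.IsMarkov G.adj (G.transition l (Real.exp ∘ u))) {m : Measure (SFT G.adj)} :
    SFT.IsEquilibriumState g m ↔ SFT.IsInvariant (G.transition l (Real.exp ∘ u)) m := by
  have := hP.nonempty
  refine hP.isEquilibriumState_iff (h := 0) fun x => ?_
  rw [(isNormalizedPotential_iff hP).1 hg, markovPotential_transition, sub_self,
    ContinuousMap.zero_apply, ContinuousMap.zero_apply, sub_self]

theorem exists_isPerronData (hP : SFT.IsMarkov G.adj (G.transition l (Real.exp ∘ u)))
    (hu : (Real.exp ∘ u) ᵥ* G.weighted l = Real.exp ∘ u) :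
    ∃ p, G.IsPerronData l (Real.exp ∘ u) p := by
  obtain ⟨p, ⟨hp, hps⟩, -⟩ := existsUnique_mulVec_eq hP.isIrreducible hP.sum_col
  exact ⟨p, fun i => Real.exp_pos _, hu, hp, hps⟩

end TransitionPotential

theorem tangentSpace_eq [Fintype E] [Nonempty (DirEdge E)]
    {P : Matrix (DirEdge E) (DirEdge E) ℝ} (hP : SFT.IsMarkov G.adj P) {p : DirEdge E → ℝ}
    (hp : P *ᵥ p = p) (hps : ∑ i, p i = 1) {m : Measure (SFT G.adj)} (hm : SFT.IsInvariant P m) :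
    G.tangentSpace m = {φ | Continuous φ ∧ ∃ ψ : DirEdge E → ℝ,
      (∀ x, φ x = ψ (x 0)) ∧ ∑ e, ψ e * p e = 0} := by
  ext φ
  constructor
  · rintro ⟨hφ, hint⟩
    choose z hz using hP.exists_zero_eq
    have hφz : φ = (SFT.cyl₁ (φ ∘ z) : C(SFT G.adj, ℝ)) := funext fun x => hφ _ _ (hz _).symm
    refine ⟨hφz ▸ ContinuousMap.continuous _, φ ∘ z, congrFun hφz, ?_⟩
    rw [← hm.integral_cyl₁ hP hp hps, ← hφz, hint]
  · rintro ⟨-, ψ, hφ, hψ⟩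
    refine ⟨fun x y hxy => by rw [hφ, hφ, hxy], ?_⟩
    rw [funext hφ, ← hψ]
    exact hm.integral_cyl₁ hP hp hps ψ

section Path

variable {n : WithTop ℕ∞} {s : Set ℝ} {l : ℝ → E → ℝ} {u : ℝ → DirEdge E → ℝ} {t : ℝ}

theorem hasDerivAt_transitionPotential [Finite E] {l' : E → ℝ} {u' : DirEdge E → ℝ}
    (hl : HasDerivAt l l' t) (hu : HasDerivAt u u' t) (i j : DirEdge E) :
    HasDerivAt (fun τ => transitionPotential (l τ) (u τ) i j)
      (transitionPotential l' u' i j) t := by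
  cases nonempty_fintype E
  exact ((hasDerivAt_pi.1 hl i.edge).neg.add (hasDerivAt_pi.1 hu i)).sub (hasDerivAt_pi.1 hu j)

theorem integral_deriv_sq_of_eq_cyl₂ (hs : IsOpen s) (ht : t ∈ s) {g : ℝ → SFT G.adj → ℝ}
    {γ : ℝ → DirEdge E → DirEdge E → ℝ} (hg : ∀ τ ∈ s, g τ = SFT.cyl₂ (γ τ))
    (m : Measure (SFT G.adj)) :
    ∫ x, deriv (fun τ => g τ x) t ^ 2 ∂m =
      ∫ x, SFT.cyl₂ (fun i j => deriv (fun τ => γ τ i j) t ^ 2) x ∂m := by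
  have hderiv (x : SFT G.adj) :
      deriv (fun τ => g τ x) t = deriv (fun τ => γ τ (x 0) (x 1)) t :=
    EventuallyEq.deriv_eq
      (eventually_of_mem (hs.mem_nhds ht) fun τ hτ => congrFun (hg τ hτ) x)
  simp only [hderiv, SFT.cyl₂_apply]

/-- A `C^n` path `l` of edge weights on `s` together with a `C^n` choice `exp ∘ u t` of positive
left eigenvectors of `G.weighted (l t)` for the eigenvalue `1`. -/
structure IsPerronPath [Fintype E] (G : UGraph V E) (n : WithTop ℕ∞) (s : Set ℝ) (l : ℝ → E → ℝ)
    (u : ℝ → DirEdge E → ℝ) : Prop where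
  contDiffOn_weight : ContDiffOn ℝ n l s
  contDiffOn_log : ContDiffOn ℝ n u s
  vecMul_eq : ∀ t ∈ s, (Real.exp ∘ u t) ᵥ* G.weighted (l t) = Real.exp ∘ u t

variable [Fintype E]

theorem exists_isPerronPath [Nonempty (DirEdge E)]
    (hadj : ∀ i j : DirEdge E, Relation.TransGen (fun a b => G.adj a b = 1) i j)
    (hl : ContDiffOn ℝ n l s) (hent : ∀ t ∈ s, l t ∈ G.entropyOne) :
    ∃ u, G.IsPerronPath n s l u := by
  have hM (i j : DirEdge E) : ContDiffOn ℝ n (fun t => G.weighted (l t) i j) s :=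
    contDiffOn_const.mul (contDiffOn_pi.1 hl i.edge).neg.exp
  obtain ⟨w, hw, hwl⟩ := exists_contDiffOn_vecMul_eq hM
    (fun t _ => weighted_isIrreducible hadj (l t)) fun t ht =>
      let ⟨u, hu⟩ := exists_exp_comp_vecMul_eq hadj (hent t ht)
      ⟨Real.exp ∘ u, fun _ => Real.exp_pos _, hu⟩
  have hexp (t : ℝ) (ht : t ∈ s) : (Real.exp ∘ fun i => Real.log (w t i)) = w t :=
    funext fun i => Real.exp_log ((hwl t ht).1 i)
  refine ⟨fun t i => Real.log (w t i), hl, ?_, fun t ht => ?_⟩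
  · exact contDiffOn_pi.2 fun i =>
      (contDiffOn_pi.1 hw i).log fun t ht => ((hwl t ht).1 i).ne'
  · rw [hexp t ht]
    exact (hwl t ht).2

namespace IsPerronPath

theorem contDiffOn_transitionPotential (hu : G.IsPerronPath n s l u) (i j : DirEdge E) :
    ContDiffOn ℝ n (fun t => transitionPotential (l t) (u t) i j) s :=
  ((contDiffOn_pi.1 hu.contDiffOn_weight i.edge).neg.add
    (contDiffOn_pi.1 hu.contDiffOn_log i)).sub (contDiffOn_pi.1 hu.contDiffOn_log j)

theorem sum_adj_mul_exp_transitionPotential (hu : G.IsPerronPath n s l u) (ht : t ∈ s)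
    (j : DirEdge E) :
    ∑ i, G.adj i j * Real.exp (transitionPotential (l t) (u t) i j) = 1 := by
  simp only [← transition_exp_comp]
  exact sum_transition (hu.vecMul_eq t ht) (fun _ => Real.exp_ne_zero _) j

theorem deriv_transitionPotential (hu : G.IsPerronPath n s l u) (hn : 2 ≤ n)
    (hs : IsOpen s) (ht : t ∈ s) (i j : DirEdge E) :
    deriv (fun τ => transitionPotential (l τ) (u τ) i j) t =
      transitionPotential (deriv l t) (deriv u t) i j :=
  have hn₀ : n ≠ 0 := (two_pos.trans_le hn).ne'
  (hasDerivAt_transitionPotential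
    ((hu.contDiffOn_weight.differentiableOn hn₀).differentiableAt (hs.mem_nhds ht)).hasDerivAt
    ((hu.contDiffOn_log.differentiableOn hn₀).differentiableAt (hs.mem_nhds ht)).hasDerivAt
    i j).deriv

theorem deriv_deriv_transitionPotential (hu : G.IsPerronPath n s l u) (hn : 2 ≤ n)
    (hs : IsOpen s) (ht : t ∈ s) (i j : DirEdge E) :
    deriv (deriv fun τ => transitionPotential (l τ) (u τ) i j) t =
      transitionPotential (deriv (deriv l) t) (deriv (deriv u) t) i j :=
  ((hasDerivAt_transitionPotential
    (differentiableAt_deriv hn hs hu.contDiffOn_weight ht).hasDerivAt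
    (differentiableAt_deriv hn hs hu.contDiffOn_log ht).hasDerivAt i j).congr_of_eventuallyEq
    (eventually_of_mem (hs.mem_nhds ht) fun _ hτ =>
      hu.deriv_transitionPotential hn hs hτ i j)).deriv

theorem sum_transition_mul_deriv (hu : G.IsPerronPath n s l u) (hn : 2 ≤ n)
    (hs : IsOpen s) (ht : t ∈ s) (j : DirEdge E) :
    ∑ i, G.transition (l t) (Real.exp ∘ u t) i j *
      transitionPotential (deriv l t) (deriv u t) i j = 0 := by
  simp only [transition_exp_comp, ← hu.deriv_transitionPotential hn hs ht]
  exact sum_mul_exp_mul_deriv_eq_zero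
    (fun i => ((hu.contDiffOn_transitionPotential i j).differentiableOn
      (two_pos.trans_le hn).ne').differentiableAt (hs.mem_nhds ht))
    (eventually_of_mem (hs.mem_nhds ht) fun τ hτ => hu.sum_adj_mul_exp_transitionPotential hτ j)

theorem sum_transition_mul_deriv_sq_add (hu : G.IsPerronPath n s l u) (hn : 2 ≤ n)
    (hs : IsOpen s) (ht : t ∈ s) (j : DirEdge E) :
    ∑ i, G.transition (l t) (Real.exp ∘ u t) i j *
      (transitionPotential (deriv l t) (deriv u t) i j ^ 2 +
        transitionPotential (deriv (deriv l) t) (deriv (deriv u) t) i j) = 0 := by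
  simp only [transition_exp_comp, ← hu.deriv_transitionPotential hn hs ht,
    ← hu.deriv_deriv_transitionPotential hn hs ht]
  exact sum_mul_exp_mul_deriv_sq_add_eq_zero hn hs
    (fun i => hu.contDiffOn_transitionPotential i j)
    (fun τ hτ => hu.sum_adj_mul_exp_transitionPotential hτ j) ht

theorem integral_deriv_sq (hu : G.IsPerronPath n s l u) (hn : 2 ≤ n) (hs : IsOpen s) (ht : t ∈ s)
    (hP : SFT.IsMarkov G.adj (G.transition (l t) (Real.exp ∘ u t))) {m : Measure (SFT G.adj)}
    (hm : SFT.IsInvariant (G.transition (l t) (Real.exp ∘ u t)) m) :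
    ∫ x, SFT.cyl₂ (fun i j => deriv (fun τ => transitionPotential (l τ) (u τ) i j) t ^ 2) x ∂m =
      ∫ x, G.onShift (deriv (deriv l) t) x ∂m := by
  simp only [hu.deriv_transitionPotential hn hs ht]
  rw [hm.integral_cyl₂_eq_integral_cyl₁_neg hP (hu.sum_transition_mul_deriv_sq_add hn hs ht)]
  exact integral_congr_ae (ae_of_all _ fun x => neg_neg (deriv (deriv l) t (x 0).edge))

theorem hasVariance (hu : G.IsPerronPath n s l u) (hn : 2 ≤ n) (hs : IsOpen s) (ht : t ∈ s)
    (hP : SFT.IsMarkov G.adj (G.transition (l t) (Real.exp ∘ u t))) {m : Measure (SFT G.adj)}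
    (hm : SFT.IsInvariant (G.transition (l t) (Real.exp ∘ u t)) m) :
    SFT.HasVariance (fun x => -G.onShift (deriv l t) x) m
      (∫ x, G.onShift (deriv (deriv l) t) x ∂m) := by
  rw [← hu.integral_deriv_sq hn hs ht hP hm]
  simp only [hu.deriv_transitionPotential hn hs ht]
  exact hm.hasVariance_cyl₁ hP (a := fun i => -deriv l t i.edge) (b := deriv u t)
    (hu.sum_transition_mul_deriv hn hs ht)

end IsPerronPath

end Path

end UGraph

end

theorem proposition3p1_general {V E : Type*} [Fintype V] [Fintype E] (G : UGraph V E)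
    (hconn : G.Connected) (hdeg : ∀ u, 2 ≤ G.degree u)
    (hrank : Fintype.card V < Fintype.card E) :
    (∀ l ∈ G.entropyOne,
      (∃! m, SFT.IsEquilibriumState (fun x => -G.onShift l x) m) ∧
      (∃ v p, G.IsPerronData l v p) ∧
      (∃! g, G.IsNormalizedPotential l g) ∧
      (∀ g, G.IsNormalizedPotential l g → ∃! m, SFT.IsEquilibriumState g m)) ∧
    (∀ l m, SFT.IsEquilibriumState (fun x => -G.onShift l x) m →
      ∀ v p, G.IsPerronData l v p →
        G.tangentSpace m =
          {φ | Continuous φ ∧ ∃ ψ : DirEdge E → ℝ,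
            (∀ x, φ x = ψ (x 0)) ∧ ∑ e, ψ e * p e = 0}) ∧
    (∀ (n : WithTop ℕ∞) (s : Set ℝ) (l : ℝ → E → ℝ) (g : ℝ → SFT G.adj → ℝ), 2 ≤ n → IsOpen s →
      ContDiffOn ℝ n l s →
      (∀ t ∈ s, l t ∈ G.entropyOne ∧ G.IsNormalizedPotential (l t) (g t)) →
      ∀ t₀ ∈ s, ∀ m m₀, SFT.IsEquilibriumState (fun x => -G.onShift (l t₀) x) m →
        SFT.IsEquilibriumState (g t₀) m₀ →
      ∀ v p, G.IsPerronData (l t₀) v p →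
        ∃ γ : ℝ → DirEdge E → DirEdge E → ℝ,
          (∀ t ∈ s, ∀ x, g t x = γ t (x 0) (x 1)) ∧
          (∀ i j, ContDiffOn ℝ n (fun t => γ t i j) s) ∧
          (∀ i j, G.transition (l t₀) v i j = G.adj i j * Real.exp (γ t₀ i j)) ∧
          SFT.HasVariance (fun x => -G.onShift (deriv l t₀) x) m
            (∫ x, G.onShift (deriv (deriv l) t₀) x ∂m) ∧
          ∫ x, G.onShift (deriv (deriv l) t₀) x ∂m
            = ∑ i : DirEdge E, deriv (deriv l) t₀ i.edge * p i ∧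
          ∑ i : DirEdge E, deriv (deriv l) t₀ i.edge * p i
            = ∫ x, (deriv (fun t => g t x) t₀) ^ 2 ∂m₀ ∧
          ∫ x, (deriv (fun t => g t x) t₀) ^ 2 ∂m₀
            = ∑ i, ∑ j, (deriv (fun t => γ t i j) t₀) ^ 2 * G.transition (l t₀) v i j * p j) := by
  have hadj := UGraph.transGen_adj hconn hdeg (by simpa only [Nat.card_eq_fintype_card] using hrank)
  have : Nonempty (DirEdge E) :=
    (Fintype.card_pos_iff.1 (Nat.zero_lt_of_lt hrank)).map fun e => (e, true)
  refine ⟨fun l hl => ?_, ?_, ?_⟩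
  · obtain ⟨u, hu⟩ := UGraph.exists_exp_comp_vecMul_eq hadj hl
    have hP := UGraph.isMarkov_transition hadj hu
    simp only [UGraph.isEquilibriumState_neg_onShift_iff hP, UGraph.isNormalizedPotential_iff hP]
    refine ⟨hP.existsUnique_isInvariant, ⟨_, UGraph.exists_isPerronData hP hu⟩, existsUnique_eq,
      fun g hg => ?_⟩
    simp only [((UGraph.isNormalizedPotential_iff hP).2 hg).isEquilibriumState_iff hP]
    exact hP.existsUnique_isInvariant
  · rintro l m hm v p ⟨hv, hvl, hp, hps⟩
    obtain ⟨u, rfl⟩ := exists_eq_exp_comp hv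
    have hP := UGraph.isMarkov_transition hadj hvl
    exact UGraph.tangentSpace_eq hP hp hps ((UGraph.isEquilibriumState_neg_onShift_iff hP).1 hm)
  · rintro n s l g hn hs hl hg t₀ ht₀ m m₀ hm hm₀ v p ⟨hv, hvl, hp, hps⟩
    obtain ⟨u, hu⟩ := UGraph.exists_isPerronPath hadj hl fun t ht => (hg t ht).1
    have hP (t : ℝ) (ht : t ∈ s) := UGraph.isMarkov_transition hadj (hu.vecMul_eq t ht)
    have hP₀ := hP t₀ ht₀
    rw [UGraph.isEquilibriumState_neg_onShift_iff hP₀] at hm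
    rw [(hg t₀ ht₀).2.isEquilibriumState_iff hP₀] at hm₀
    rw [UGraph.transition_eq_of_vecMul_eq hadj (fun _ => Real.exp_pos _) (hu.vecMul_eq t₀ ht₀)
      hv hvl] at hp ⊢
    have hgγ (t : ℝ) (ht : t ∈ s) := (UGraph.isNormalizedPotential_iff (hP t ht)).1 (hg t ht).2
    have hġ := UGraph.integral_deriv_sq_of_eq_cyl₂ hs ht₀ hgγ m₀
    have hsum {m} (hm) := SFT.IsInvariant.integral_cyl₁ (m := m) hm hP₀ hp hps
      fun i => deriv (deriv l) t₀ i.edge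
    exact ⟨fun t => UGraph.transitionPotential (l t) (u t), fun t ht => congrFun (hgγ t ht),
      hu.contDiffOn_transitionPotential, UGraph.transition_exp_comp,
      hu.hasVariance hn hs ht₀ hP₀ hm, hsum hm,
      (hsum hm₀).symm.trans (hġ.trans (hu.integral_deriv_sq hn hs ht₀ hP₀ hm₀)).symm,
      hġ.trans (hm₀.integral_cyl₂_eq_sum hP₀ hp hps _)⟩

theorem proposition3p1 {V E : Type*} [Fintype V] [Fintype E] (G : UGraph V E)
    (hconn : G.Connected) (hdeg : ∀ u, 2 ≤ G.degree u)
    (hrank : Fintype.card V < Fintype.card E) :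
    -- the objects in the statement exist
    (∀ l ∈ G.entropyOne,
      (∃! m, SFT.IsEquilibriumState (fun x => -G.onShift l x) m) ∧
      (∃ v p, G.IsPerronData l v p) ∧
      (∃! g, G.IsNormalizedPotential l g) ∧
      (∀ g, G.IsNormalizedPotential l g → ∃! m, SFT.IsEquilibriumState g m)) ∧
    -- (1) the tangent space
    (∀ l ∈ G.entropyOne, ∀ m, SFT.IsEquilibriumState (fun x => -G.onShift l x) m →
      ∀ v p, G.IsPerronData l v p →
        G.tangentSpace m =
          {φ | Continuous φ ∧ ∃ ψ : DirEdge E → ℝ,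
            (∀ x, φ x = ψ (x 0)) ∧ ∑ e, ψ e * p e = 0}) ∧
    -- (2) the variance along a smooth path
    (∀ (ε : ℝ) (l : ℝ → E → ℝ) (g : ℝ → SFT G.adj → ℝ), 0 < ε →
      ContDiffOn ℝ ∞ l (Set.Ioo (-ε) ε) →
      (∀ t ∈ Set.Ioo (-ε) ε, l t ∈ G.entropyOne ∧ G.IsNormalizedPotential (l t) (g t)) →
      ∀ m m₀, SFT.IsEquilibriumState (fun x => -G.onShift (l 0) x) m →
        SFT.IsEquilibriumState (g 0) m₀ →
      ∀ v p, G.IsPerronData (l 0) v p →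
        ∃ γ : ℝ → DirEdge E → DirEdge E → ℝ,
          (∀ t ∈ Set.Ioo (-ε) ε, ∀ x, g t x = γ t (x 0) (x 1)) ∧
          (∀ i j, ContDiffOn ℝ ∞ (fun t => γ t i j) (Set.Ioo (-ε) ε)) ∧
          (∀ i j, G.transition (l 0) v i j = G.adj i j * Real.exp (γ 0 i j)) ∧
          SFT.HasVariance (fun x => -G.onShift (deriv l 0) x) m
            (∫ x, G.onShift (deriv (deriv l) 0) x ∂m) ∧
          ∫ x, G.onShift (deriv (deriv l) 0) x ∂m
            = ∑ i : DirEdge E, deriv (deriv l) 0 i.edge * p i ∧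
          ∑ i : DirEdge E, deriv (deriv l) 0 i.edge * p i
            = ∫ x, (deriv (fun t => g t x) 0) ^ 2 ∂m₀ ∧
          ∫ x, (deriv (fun t => g t x) 0) ^ 2 ∂m₀
            = ∑ i, ∑ j, (deriv (fun t => γ t i j) 0) ^ 2 * G.transition (l 0) v i j * p j) := by
  obtain ⟨hexist, htangent, hpath⟩ := proposition3p1_general G hconn hdeg hrank
  exact ⟨hexist, fun l _ => htangent l, fun ε l g hε hl hg =>
    hpath ∞ _ l g (WithTop.coe_le_coe.2 le_top) isOpen_Ioo hl hg 0 ⟨neg_neg_of_pos hε, hε⟩⟩
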